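/- **Notation.** A partition $\lambda=(\lambda_1\ge\lambda_2\ge\cdots)$ is identified with its Young diagram $D(\lambda)=\{(i,j): i\ge 1,\ 1\le j\le\lambda_i\}$; $\lambda'$ is its conjugate. For $M\in\mathbb{N}$ and a sequence $\boldsymbol a=(a_c)_{c\in\mathbb{Z}}$ of complex numbers, the truncated diagonally constant Schur multiple zeta function is $$\zeta^M_\lambda(\boldsymbol a)=\sum_{(t_{i,j})}\ \prod_{(i,j)\in D(\lambda)}t_{i,j}^{-a_{j-i}},$$ where $(t_{i,j})$ runs over the semistandard Young tableaux of shape $\lambda$ (rows weakly increasing, columns strictly increasing) with entries in $\{1,\dots,M\}$. For $m\in\mathbb{Z}$ put $\tau^m\boldsymbol a=(a_{c+m})_{c\in\mathbb{Z}}$. A corner of $\lambda$ is a box $(i,j)\in D(\lambda)$ with $(i+1,j),(i,j+1)\notin D(\lambda)$. If $\lambda$ has $n$ corners, write them as $(r_1,m_1),\dots,(r_n,m_n)$ with $r_1<\cdots<r_n$ and $m_1>\cdots>m_n$, and put $m_{n+1}=0$. The outside border of a partition consists of the boxes not in its diagram that are immediately below, to the right of, or diagonally below and to the right of a box of the diagram.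 The inside border consists of the boxes $(i,j)$ of the diagram for which $(i+1,j+1)$ is not in the diagram. Both are strips running from the upper right to the lower left. For boxes $u,v$ of the outside border of $\nu$ let $\mathrm{add}^u_v(\nu)$ be the partition whose diagram is obtained from $\nu$ by adding the substrip of the outside border from $u$ to $v$; for $u,v$ in the inside border let $\mathrm{rem}^u_v(\nu)$ be the partition whose diagram is obtained by removing the substrip of the inside border from $u$ to $v$ (in each case, if the result is a Young diagram). With the corners $(r_i,m_i)$ of the fixed partition $\lambda$, put $$\mathrm{add}^p_q=\mathrm{add}^{(r_p+1,\,m_p)}_{(r_q+1,\,m_{q+1}+1)},\qquad \mathrm{rem}^p_q=\mathrm{rem}^{(r_p,\,m_p)}_{(r_q,\,m_{q+1}+1)}\qquad(1\le p\le q\le n),$$ and, for $1\le p_1<\cdots<p_t\le q_t<\cdots<q_1\le n$, put $\mathrm{add}^{p_1,\dots,p_t}_{q_1,\dots,q_t}(\lambda)=(\mathrm{add}^{p_1}_{q_1}\circ\cdots\circ\mathrm{add}^{p_t}_{q_t})(\lambda)$ and $\mathrm{rem}^{p_1,\dots,p_t}_{q_1,\dots,q_t}(\lambda)=(\mathrm{rem}^{p_1}_{q_1}\circ\cdots\circ\mathrm{rem}^{p_t}_{q_t})(\lambda)$.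 Finally, $\lambda\pm(1^\ell)$ is obtained from $\lambda$ by replacing $\lambda_i$ with $\lambda_i\pm1$ for $1\le i\le\ell$. **Statement.** Let $M\in\mathbb{N}$ and $\boldsymbol a=(a_c)_{c\in\mathbb{Z}}\in\mathbb{C}^{\mathbb{Z}}$, let $\lambda$ be a partition with $n$ corners, and let $1\le d\le n$. 1. Let $\ell$ be the $d$-th smallest of the distinct column heights of $\lambda$. Then all the partitions below are defined, and $$\zeta^{M}_{\lambda}(\boldsymbol a)\,\zeta^{M}_{\lambda}(\tau^{-1}\boldsymbol a) =\zeta^{M}_{\lambda-(1^{\ell})}(\boldsymbol a)\,\zeta^{M}_{\lambda+(1^{\ell})}(\tau^{-1}\boldsymbol a) +\sum^{\min\{d,n-d+1\}}_{t=1}(-1)^{t-1} \sum_{\substack{1\le p_1<\cdots<p_t\le d \\ d\le q_t<\cdots<q_1\le n}} \zeta^{M}_{\mathrm{add}^{p_1,\ldots,p_t}_{q_1,\ldots,q_t}(\lambda)}(\boldsymbol a)\, \zeta^{M}_{\mathrm{rem}^{p_1,\ldots,p_t}_{q_1,\ldots,q_t}(\lambda)}(\tau^{-1}\boldsymbol a).$$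 2. Let $\ell$ be the $d$-th smallest of the distinct row lengths of $\lambda$. Then all the partitions below are defined (the operators $\mathrm{add}$ and $\mathrm{rem}$ now being formed with the corners of $\lambda'$), and $$\zeta^{M}_{\lambda}(\boldsymbol a)\,\zeta^{M}_{\lambda}(\tau\boldsymbol a) =\zeta^{M}_{(\lambda'-(1^{\ell}))'}(\boldsymbol a)\,\zeta^{M}_{(\lambda'+(1^{\ell}))'}(\tau\boldsymbol a) +\sum^{\min\{d,n-d+1\}}_{t=1}(-1)^{t-1} \sum_{\substack{1\le p_1<\cdots<p_t\le d \\ d\le q_t<\cdots<q_1\le n}} \zeta^{M}_{(\mathrm{add}^{p_1,\ldots,p_t}_{q_1,\ldots,q_t}(\lambda'))'}(\boldsymbol a)\, \zeta^{M}_{(\mathrm{rem}^{p_1,\ldots,p_t}_{q_1,\ldots,q_t}(\lambda'))'}(\tau\boldsymbol a).$$ -/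

import Mathlib

namespace SchurZeta

/-! Mathlib's `YoungDiagram` and `SemistandardYoungTableau` number rows and columns from `0`.
`cellAt i j` is the box in the `i`-th row and the `j`-th column when they are numbered from `1`
as usual. -/

/-- The box `(i, j)` in the usual numbering of rows and columns by `1, 2, …`. -/
def cellAt (i j : ℕ) : ℕ × ℕ := (i - 1, j - 1)

/-- The content `c(i, j) = j - i` of a box. -/
def content (x : ℕ × ℕ) : ℤ := (x.2 : ℤ) - (x.1 : ℤ)

/-! ### Truncated Schur multiple zeta functions -/

/-- The semistandard Young tableaux of shape `lam` all of whose entries lie in `{1, …, M}`. -/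
def truncSSYT (M : ℕ) (lam : YoungDiagram) : Set (SemistandardYoungTableau lam) :=
  {T | ∀ x ∈ lam.cells, 1 ≤ T x.1 x.2 ∧ T x.1 x.2 ≤ M}

theorem truncSSYT_finite (M : ℕ) (lam : YoungDiagram) : (truncSSYT M lam).Finite := by
  refine Set.Finite.of_finite_image
    (f := fun (T : SemistandardYoungTableau lam) (x : lam.cells) => T x.1.1 x.1.2) ?_ ?_
  · refine (Set.Finite.pi' (t := fun _ : lam.cells => Set.Iic M)
      fun _ => Set.finite_Iic M).subset ?_
    rintro _ ⟨T, hT, rfl⟩ x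
    exact (hT x.1 x.2).2
  · intro T _ T' _ h
    ext i j
    by_cases hij : (i, j) ∈ lam
    · exact congrFun h ⟨(i, j), (lam.mem_cells _).2 hij⟩
    · rw [T.zeros hij, T'.zeros hij]

/-- The `M`-truncated Schur multiple zeta function `ζ^M_λ(s)` of an index `s`, i.e. of a filling
of the boxes of `lam` by complex numbers. -/
noncomputable def truncZeta (M : ℕ) (lam : YoungDiagram) (s : lam.cells → ℂ) : ℂ :=
  ∑ T ∈ (truncSSYT_finite M lam).toFinset,
    ∏ x : lam.cells, ((T x.1.1 x.1.2 : ℕ) : ℂ) ^ (-(s x))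

/-- The diagonally constant index `a|_λ = (a_{c(i,j)})`. -/
def diagIndex (a : ℤ → ℂ) (lam : YoungDiagram) : lam.cells → ℂ := fun x => a (content x.1)

/-- The shift `τ^m a = (a_{c+m})_c`. -/
def shift (m : ℤ) (a : ℤ → ℂ) : ℤ → ℂ := fun c => a (c + m)

/-- `ζ^M_λ(a) = ζ^M_λ(a|_λ)`. The shape is an `Option`, because the operations on diagrams below
are partial; the value at an undefined shape is `0`. -/
noncomputable def diagZeta (M : ℕ) (lam : Option YoungDiagram) (a : ℤ → ℂ) : ℂ :=
  lam.elim 0 fun nu => truncZeta M nu (diagIndex a nu)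

/-! ### Corners and borders of a Young diagram -/

/-- The set of corners of `lam`. -/
def corners (lam : YoungDiagram) : Finset (ℕ × ℕ) :=
  lam.cells.filter fun x => (x.1 + 1, x.2) ∉ lam.cells ∧ (x.1, x.2 + 1) ∉ lam.cells

/-- The `k`-th smallest element (`k = 1, 2, …, s.card`) of a finite set of natural numbers
(`0` if `k` is larger than `s.card`). -/
def nthSmallest (s : Finset ℕ) (k : ℕ) : ℕ := (s.sort (· ≤ ·)).getD (k - 1) 0

/-- `r_p`: the row (numbered from `1`) of the `p`-th corner from the top. -/
def cornerRow (lam : YoungDiagram) (p : ℕ) : ℕ :=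
  nthSmallest ((corners lam).image fun x => x.1 + 1) p

/-- `m_p`: the column (numbered from `1`) of the `p`-th corner from the top, that is, the length
of the row `r_p`; moreover `m_{n+1} = 0` if there are `n` corners. -/
def cornerCol (lam : YoungDiagram) (p : ℕ) : ℕ :=
  if 1 ≤ p ∧ p ≤ (corners lam).card then lam.rowLen (cornerRow lam p - 1) else 0

/-- The set of the heights of the columns of `lam`. -/
def colHeights (lam : YoungDiagram) : Finset ℕ := (Finset.range (lam.rowLen 0)).image lam.colLen

/-- The set of the lengths of the rows of `lam`. -/
def rowLengths (lam : YoungDiagram) : Finset ℕ := (Finset.range (lam.colLen 0)).image lam.rowLen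

/-- The outside border of `lam`: the boxes which are not in `lam`, but immediately below, to the
right, or diagonally below and to the right of a box of `lam`. -/
def outsideBorder (lam : YoungDiagram) : Finset (ℕ × ℕ) :=
  (lam.cells.image (fun x => (x.1 + 1, x.2)) ∪ lam.cells.image (fun x => (x.1, x.2 + 1)) ∪
    lam.cells.image (fun x => (x.1 + 1, x.2 + 1))) \ lam.cells

/-- The inside border (rim) of `lam`: the boxes of `lam` whose neighbour diagonally below and to
the right is not in `lam`. -/
def insideBorder (lam : YoungDiagram) : Finset (ℕ × ℕ) :=
  lam.cells.filter fun x => (x.1 + 1, x.2 + 1) ∉ lam.cells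

/-- The substrip of the border strip `B` which starts at `u` and ends at `v`. A border strip
is a path of boxes from the upper right to the lower left, so that these are its boxes which lie
weakly below and to the left of `u` and weakly above and to the right of `v`. -/
def substrip (B : Finset (ℕ × ℕ)) (u v : ℕ × ℕ) : Finset (ℕ × ℕ) :=
  B.filter fun x => u.1 ≤ x.1 ∧ x.1 ≤ v.1 ∧ v.2 ≤ x.2 ∧ x.2 ≤ u.2

/-! ### Operations on Young diagrams

They are partial: the value is `none` if the operation is not defined. -/

open Classical in
/-- The Young diagram with the given set of boxes, if there is one. -/
noncomputable def ofCells (s : Finset (ℕ × ℕ)) : Option YoungDiagram :=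
  if h : IsLowerSet (s : Set (ℕ × ℕ)) then some ⟨s, h⟩ else none

open Classical in
/-- The Young diagram with the given (possibly zero) row lengths, if they are non-increasing. -/
noncomputable def ofRows (w : List ℕ) : Option YoungDiagram :=
  if h : w.SortedGE then some (YoungDiagram.ofRowLens w h) else none

/-- `add^u_v(λ)`. -/
noncomputable def addStrip (u v : ℕ × ℕ) (lam : YoungDiagram) : Option YoungDiagram :=
  if u ∈ outsideBorder lam ∧ v ∈ outsideBorder lam then
    ofCells (lam.cells ∪ substrip (outsideBorder lam) u v) else none

/-- `rem^u_v(λ)`. -/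
noncomputable def remStrip (u v : ℕ × ℕ) (lam : YoungDiagram) : Option YoungDiagram :=
  if u ∈ insideBorder lam ∧ v ∈ insideBorder lam then
    ofCells (lam.cells \ substrip (insideBorder lam) u v) else none

/-- The operator `add^p_q = add^{(r_p+1, m_p)}_{(r_q+1, m_{q+1}+1)}` belonging to the corners
`(r_i, m_i)` of `lam`, applied to a diagram `nu`. -/
noncomputable def addCorner (lam : YoungDiagram) (p q : ℕ) (nu : YoungDiagram) :
    Option YoungDiagram :=
  addStrip (cellAt (cornerRow lam p + 1) (cornerCol lam p))
    (cellAt (cornerRow lam q + 1) (cornerCol lam (q + 1) + 1)) nu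

/-- The operator `rem^p_q = rem^{(r_p, m_p)}_{(r_q, m_{q+1}+1)}` belonging to the corners
`(r_i, m_i)` of `lam`, applied to a diagram `nu`. -/
noncomputable def remCorner (lam : YoungDiagram) (p q : ℕ) (nu : YoungDiagram) :
    Option YoungDiagram :=
  remStrip (cellAt (cornerRow lam p) (cornerCol lam p))
    (cellAt (cornerRow lam q) (cornerCol lam (q + 1) + 1)) nu

/-- `add^{p_1,…,p_t}_{q_1,…,q_t}(λ) = (add^{p_1}_{q_1} ∘ ⋯ ∘ add^{p_t}_{q_t})(λ)`. -/
noncomputable def addCorners (lam : YoungDiagram) {t : ℕ} (p q : Fin t → ℕ) :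
    Option YoungDiagram :=
  (List.ofFn fun i => addCorner lam (p i) (q i)).foldr (fun f o => o.bind f) (some lam)

/-- `rem^{p_1,…,p_t}_{q_1,…,q_t}(λ) = (rem^{p_1}_{q_1} ∘ ⋯ ∘ rem^{p_t}_{q_t})(λ)`. -/
noncomputable def remCorners (lam : YoungDiagram) {t : ℕ} (p q : Fin t → ℕ) :
    Option YoungDiagram :=
  (List.ofFn fun i => remCorner lam (p i) (q i)).foldr (fun f o => o.bind f) (some lam)

/-- `λ + (1^l)`: add `1` to the first `l` parts. -/
noncomputable def addOnes (lam : YoungDiagram) (l : ℕ) : Option YoungDiagram :=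
  ofRows (lam.rowLens.mapIdx fun i x => if i < l then x + 1 else x)

/-- `λ - (1^l)`: subtract `1` from the first `l` parts (which are positive). -/
noncomputable def subOnes (lam : YoungDiagram) (l : ℕ) : Option YoungDiagram :=
  ofRows (lam.rowLens.mapIdx fun i x => if i < l then x - 1 else x)

/-- The conjugate of a possibly undefined diagram. -/
def conjDiagram (o : Option YoungDiagram) : Option YoungDiagram := o.map YoungDiagram.transpose

/-- The pairs of sequences `1 ≤ p_1 < ⋯ < p_t ≤ d` and `d ≤ q_t < ⋯ < q_1 ≤ n`. -/
def nestedPairs (n d t : ℕ) : Finset ((Fin t → ℕ) × (Fin t → ℕ)) :=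
  ((Fintype.piFinset fun _ => Finset.Icc 1 d) ×ˢ
    (Fintype.piFinset fun _ => Finset.Icc d n)).filter fun x =>
      (∀ i j, i < j → x.1 i < x.1 j) ∧ (∀ i j, i < j → x.2 j < x.2 i)

end SchurZeta

open SchurZeta

/-! Both identities come from one relation between determinants. A Jacobi–Trudi formula
(`tableauSum_eq_rowDet_hCoeff`) and its dual (`tableauSum_transpose_eq_rowDet_eCoeff`) write the
zeta function of a shape `ν`, respectively of its conjugate, as a determinant whose row `i` depends
only on `ν_i - i`. The shift of `a` lowers this number and the column label `-s` by one. Let `k` be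
the number of rows of `λ`, numbered from `0`. The first factor is taken of size `k + 1`, to leave
room for a row created by an added strip; the second has size `k` and is bordered to size `k + 1`.
The left-hand side becomes `det f * det g`, where `f_i` belongs to `λ_i - i`, `g_i` to `λ_i - i - 1`
for `i < k`, and `g_k` is a multiple of a unit vector.

Passing to `λ - (1^l)` and `λ + (1^l)` exchanges the rows `i < l` of `f` and `g`. The product of the
exchanged determinants is a sum of determinants of twice the size
(`rowDet_mul_rowDet_eq_sum_exchangeMatrix`), over sets of moved rows: rows `i ≥ l` of `f` and rows
`i < l` of `g`. A term vanishes unless equally many rows of both kinds move. Moreover `f_{i+1} =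
g_i` whenever `λ_i = λ_{i+1}`, so in a nonzero term the moved rows of `g` are rows of corners `p ≤
d`, and those of `f` lie just below corners `q ≥ d`. The surviving terms are therefore indexed by
nested sequences, and exchanging `t` pairs of rows gives the sign `(-1)^t`.

Putting the `g`-row of corner `p` in place of the `f`-row below corner `q` amounts, up to a cyclic
permutation of rows, to adding the strip from `p` to `q`; the opposite replacement in `g` removes
such a strip (`addCorners_eq_some`, `remCorners_eq_some`). The two permutations have equal signs,
which cancel. The term `t = 0` is the left-hand side of the theorem. `exchange_identity` carries
this out for an abstract determinant and is applied to `λ` and to its conjugate. -/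

namespace SchurZeta

/-! ### An exchange relation for products of two determinants -/

section Exchange

open Matrix

variable {ι R : Type*} [DecidableEq ι] [CommRing R]

/-- The determinant of the matrix with the rows `f i`. -/
def rowDet [Fintype ι] (f : ι → ι → R) : R := det (of f)

theorem rowDet_eq_zero_of_eq [Fintype ι] {f : ι → ι → R} {i j : ι} (hij : i ≠ j)
    (h : f i = f j) : rowDet f = 0 :=
  det_zero_of_row_eq (M := of f) hij h

theorem rowDet_comp_perm [Fintype ι] (σ : Equiv.Perm ι) (f : ι → ι → R) :
    rowDet (fun i => f (σ i)) = Equiv.Perm.sign σ * rowDet f :=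
  det_permute σ (of f)

/-- The rows `(f_i, 0)` and `(0, g_i)`, with those in `s` replaced by `(0, f_i)` and `(g_i, 0)`. -/
def exchangeMatrix (f g : ι → ι → R) (s : Finset (ι ⊕ ι)) : ι ⊕ ι → ι ⊕ ι → R
  | Sum.inl i => if Sum.inl i ∈ s then Sum.elim 0 (f i) else Sum.elim (f i) 0
  | Sum.inr i => if Sum.inr i ∈ s then Sum.elim (g i) 0 else Sum.elim 0 (g i)

/-- The indices of the rows of `f` outside `L` and of those of `g` in `L`. -/
def exchangeSupport [Fintype ι] (L : Finset ι) : Finset (ι ⊕ ι) :=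
  Lᶜ.image Sum.inl ∪ L.image Sum.inr

@[simp] theorem inl_mem_exchangeSupport [Fintype ι] {L : Finset ι} {i : ι} :
    Sum.inl i ∈ exchangeSupport L ↔ i ∉ L := by
  simp [exchangeSupport]

@[simp] theorem inr_mem_exchangeSupport [Fintype ι] {L : Finset ι} {i : ι} :
    Sum.inr i ∈ exchangeSupport L ↔ i ∈ L := by
  simp [exchangeSupport]

/-- Both sides are the determinant of the block matrix `(F, F - eF; eG, G)`, where `e` projects onto
the rows in `L`: one side by multilinearity in the rows of the support, the other by row and column
operations. -/
theorem rowDet_mul_rowDet_eq_sum_exchangeMatrix [Fintype ι] (f g : ι → ι → R) (L : Finset ι) :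
    rowDet (fun i => if i ∈ L then g i else f i) * rowDet (fun i => if i ∈ L then f i else g i) =
      ∑ s ∈ (exchangeSupport L).powerset, rowDet (exchangeMatrix f g s) := by
  let F : Matrix ι ι R := of f
  let G : Matrix ι ι R := of g
  let e : Matrix ι ι R := diagonal fun i => if i ∈ L then 1 else 0
  have he : e * e = e := by
    simp only [e, diagonal_mul_diagonal]
    congr 1
    funext i
    split_ifs <;> simp
  have hmul : ∀ (A : Matrix ι ι R) (i j : ι), (e * A) i j = if i ∈ L then A i j else 0 := by
    intro A i j
    simp [e, diagonal_mul]
  -- Each row of the support is a sum of its unmoved form (value at `∅`) and its moved form (value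
  -- at `univ`), for instance `(f_i, f_i) = (f_i, 0) + (0, f_i)`.
  have key := (detRowAlternating (R := R) (n := ι ⊕ ι)).toMultilinearMap.map_piecewise_add
    (exchangeMatrix f g Finset.univ) (exchangeMatrix f g ∅) (exchangeSupport L)
  have hs : ∀ s, s.piecewise (exchangeMatrix f g Finset.univ) (exchangeMatrix f g ∅) =
      exchangeMatrix f g s := by
    intro s
    funext x
    rcases x with i | i <;> simp [exchangeMatrix, Finset.piecewise]
  simp only [hs] at key
  have hsum : of ((exchangeSupport L).piecewise
      (exchangeMatrix f g Finset.univ + exchangeMatrix f g ∅) (exchangeMatrix f g ∅)) =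
      fromBlocks F (F - e * F) (e * G) G := by
    ext x y
    rcases x with i | i <;> rcases y with j | j <;>
      by_cases hi : i ∈ L <;> simp [Finset.piecewise, exchangeMatrix, hi, hmul, F, G]
  -- After a column operation, the three shears on the left exchange the two blocks of rows in `L`
  -- up to a sign and leave a block triangular matrix.
  have hQ : (fromBlocks 1 e 0 1 : Matrix (ι ⊕ ι) (ι ⊕ ι) R) *
      (fromBlocks 1 0 (-e) 1 * (fromBlocks 1 e 0 1 *
        (fromBlocks F (F - e * F) (e * G) G * fromBlocks 1 (-1) 0 1))) =
      fromBlocks (e * G + (F - e * F)) 0 (-(e * F)) (e * F + (G - e * G)) := by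
    simp only [fromBlocks_multiply, Matrix.one_mul, Matrix.mul_one, Matrix.zero_mul,
      Matrix.mul_zero, Matrix.mul_neg, Matrix.neg_mul, Matrix.mul_add, Matrix.mul_sub,
      ← Matrix.mul_assoc, he, add_zero, zero_add]
    congr 1 <;> abel
  have hdet := congrArg det hQ
  simp only [det_mul, det_fromBlocks_zero₂₁, det_fromBlocks_zero₁₂, det_one, one_mul, mul_one]
    at hdet
  have h1 : of (fun i => if i ∈ L then g i else f i) = e * G + (F - e * F) := by
    ext i j
    by_cases hi : i ∈ L <;> simp [hmul, hi, F, G]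
  have h2 : of (fun i => if i ∈ L then f i else g i) = e * F + (G - e * G) := by
    ext i j
    by_cases hi : i ∈ L <;> simp [hmul, hi, F, G]
  rw [rowDet, rowDet, h1, h2, ← hdet, ← hsum]
  exact key

/-- Each row is supported in one half of the columns. A nonzero term of the Leibniz formula matches
rows to columns bijectively, so exactly half of the rows live in each half. -/
theorem card_eq_of_rowDet_exchangeMatrix_ne_zero [Fintype ι] {f g : ι → ι → R}
    {s : Finset (ι ⊕ ι)} (h : rowDet (exchangeMatrix f g s) ≠ 0) :
    (Finset.univ.filter fun i => Sum.inl i ∈ s).card =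
      (Finset.univ.filter fun i => Sum.inr i ∈ s).card := by
  rw [rowDet, ← det_transpose, det_apply] at h
  obtain ⟨σ, -, hσ⟩ := Finset.exists_ne_zero_of_sum_ne_zero h
  have hne : ∀ x, exchangeMatrix f g s x (σ x) ≠ 0 := by
    intro x hx
    refine hσ ?_
    rw [Finset.prod_eq_zero (Finset.mem_univ x) (by simpa using hx), smul_zero]
  have hl : ∀ i, ((σ (Sum.inl i)).isRight ↔ Sum.inl i ∈ s) := by
    intro i
    have := hne (Sum.inl i)
    by_cases hi : Sum.inl i ∈ s <;> rcases hσi : σ (Sum.inl i) with j | j <;>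
      simp [exchangeMatrix, hi, hσi] at this ⊢
  have hr : ∀ i, ((σ (Sum.inr i)).isRight ↔ Sum.inr i ∉ s) := by
    intro i
    have := hne (Sum.inr i)
    by_cases hi : Sum.inr i ∈ s <;> rcases hσi : σ (Sum.inr i) with j | j <;>
      simp [exchangeMatrix, hi, hσi] at this ⊢
  have hc : ∑ x : ι ⊕ ι, (if (σ x).isRight then 1 else 0) =
      ∑ x : ι ⊕ ι, (if x.isRight then 1 else 0) :=
    Equiv.sum_comp σ fun x => if x.isRight then 1 else 0
  simp only [Fintype.sum_sum_type, hl, hr, Sum.isRight_inl, Sum.isRight_inr] at hc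
  rw [← Finset.card_filter, ← Finset.card_filter] at hc
  have hcompl := Finset.card_filter_add_card_filter_not (s := (Finset.univ : Finset ι))
    (fun i => Sum.inr i ∈ s)
  simp at hc hcompl
  omega

/-- The moved row `(0, f_j)` coincides with the unmoved row `(0, g_i)`. -/
theorem rowDet_exchangeMatrix_eq_zero_of_inl [Fintype ι] {f g : ι → ι → R} {s : Finset (ι ⊕ ι)}
    {i j : ι} (hj : Sum.inl j ∈ s) (hi : Sum.inr i ∉ s) (h : f j = g i) :
    rowDet (exchangeMatrix f g s) = 0 := by
  refine rowDet_eq_zero_of_eq (i := Sum.inl j) (j := Sum.inr i) (by simp) ?_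
  funext y
  rcases y with y | y <;> simp [exchangeMatrix, hj, hi, h]

theorem rowDet_exchangeMatrix_eq_zero_of_inr [Fintype ι] {f g : ι → ι → R} {s : Finset (ι ⊕ ι)}
    {i j : ι} (hi : Sum.inr i ∈ s) (hj : Sum.inl j ∉ s) (h : f j = g i) :
    rowDet (exchangeMatrix f g s) = 0 := by
  refine rowDet_eq_zero_of_eq (i := Sum.inl j) (j := Sum.inr i) (by simp) ?_
  funext y
  rcases y with y | y <;> simp [exchangeMatrix, hj, hi, h]

/-- The set of rows `q_1, …, q_t` of the first and `p_1, …, p_t` of the second matrix. -/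
def exchangeSet {t : ℕ} (p q : Fin t → ι) : Finset (ι ⊕ ι) :=
  Finset.univ.image (fun k => Sum.inl (q k)) ∪ Finset.univ.image (fun k => Sum.inr (p k))

@[simp] theorem inl_mem_exchangeSet {t : ℕ} {p q : Fin t → ι} {i : ι} :
    Sum.inl i ∈ exchangeSet p q ↔ ∃ k, q k = i := by
  simp [exchangeSet]

@[simp] theorem inr_mem_exchangeSet {t : ℕ} {p q : Fin t → ι} {i : ι} :
    Sum.inr i ∈ exchangeSet p q ↔ ∃ k, p k = i := by
  simp [exchangeSet]

theorem extend_succ_eq_update {α : Type*} {t : ℕ} {q : Fin (t + 1) → ι}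
    (hq : Function.Injective q) (u : Fin (t + 1) → α) (f : ι → α) :
    Function.extend q u f =
      Function.update (Function.extend (fun k : Fin t => q k.succ) (fun k => u k.succ) f) (q 0) (u 0) := by
  have hq' : Function.Injective fun k : Fin t => q k.succ := hq.comp (Fin.succ_injective t)
  funext i
  by_cases h : ∃ k, q k = i
  · obtain ⟨k, rfl⟩ := h
    rw [hq.extend_apply]
    rcases Fin.eq_zero_or_eq_succ k with rfl | ⟨k, rfl⟩
    · simp
    · rw [Function.update_of_ne (fun h => absurd (hq h) (Fin.succ_ne_zero k))]
      exact (hq'.extend_apply (fun k => u k.succ) f k).symm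
  · have h0 : i ≠ q 0 := fun h0 => h ⟨0, h0.symm⟩
    rw [Function.extend_apply' _ _ _ h, Function.update_of_ne h0, Function.extend_apply']
    rintro ⟨k, hk⟩
    exact h ⟨_, hk⟩

/-- For no moved rows the matrix is block diagonal. Each further pair amounts to transposing two
rows after exchanging `f (q 0)` and `g (p 0)`, at the cost of one sign. -/
theorem rowDet_exchangeMatrix_exchangeSet [Fintype ι] {t : ℕ} {p q : Fin t → ι}
    (hp : Function.Injective p) (hq : Function.Injective q) (f g : ι → ι → R) :
    rowDet (exchangeMatrix f g (exchangeSet p q)) =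
      (-1) ^ t * (rowDet (Function.extend q (fun k => g (p k)) f) *
        rowDet (Function.extend p (fun k => f (q k)) g)) := by
  induction t generalizing f g with
  | zero =>
    have hs : exchangeSet p q = ∅ := by simp [exchangeSet]
    have h1 : Function.extend q (fun k => g (p k)) f = f :=
      funext fun i => Function.extend_apply' _ _ _ (by simp)
    have h2 : Function.extend p (fun k => f (q k)) g = g :=
      funext fun i => Function.extend_apply' _ _ _ (by simp)
    have h3 : of (exchangeMatrix f g ∅) = fromBlocks (of f) 0 0 (of g) := by
      ext x y
      rcases x with i | i <;> rcases y with j | j <;> simp [exchangeMatrix]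
    rw [hs, h1, h2, rowDet, h3, det_fromBlocks_zero₂₁]
    simp [rowDet]
  | succ t ih =>
    let f' : ι → ι → R := Function.update f (q 0) (g (p 0))
    let g' : ι → ι → R := Function.update g (p 0) (f (q 0))
    have hp' : Function.Injective fun k : Fin t => p k.succ := hp.comp (Fin.succ_injective t)
    have hq' : Function.Injective fun k : Fin t => q k.succ := hq.comp (Fin.succ_injective t)
    have hp0 : ∀ k : Fin t, p k.succ ≠ p 0 := fun k h => Fin.succ_ne_zero k (hp h)
    have hq0 : ∀ k : Fin t, q k.succ ≠ q 0 := fun k h => Fin.succ_ne_zero k (hq h)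
    have hfg : Function.extend q (fun k => g (p k)) f =
        Function.extend (fun k : Fin t => q k.succ) (fun k => g' (p k.succ)) f' := by
      rw [extend_succ_eq_update hq]
      funext i
      by_cases hi : i = q 0
      · subst hi
        rw [Function.update_self, Function.extend_apply' _ _ _ (by rintro ⟨k, hk⟩; exact hq0 k hk)]
        simp [f']
      · rw [Function.update_of_ne hi]
        by_cases h : ∃ k : Fin t, q k.succ = i
        · obtain ⟨k, rfl⟩ := h
          rw [hq'.extend_apply, hq'.extend_apply]
          simp [g', hp0]
        · rw [Function.extend_apply' _ _ _ h, Function.extend_apply' _ _ _ h]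
          simp [f', hi]
    have hgf : Function.extend p (fun k => f (q k)) g =
        Function.extend (fun k : Fin t => p k.succ) (fun k => f' (q k.succ)) g' := by
      rw [extend_succ_eq_update hp]
      funext i
      by_cases hi : i = p 0
      · subst hi
        rw [Function.update_self, Function.extend_apply' _ _ _ (by rintro ⟨k, hk⟩; exact hp0 k hk)]
        simp [g']
      · rw [Function.update_of_ne hi]
        by_cases h : ∃ k : Fin t, p k.succ = i
        · obtain ⟨k, rfl⟩ := h
          rw [hp'.extend_apply, hp'.extend_apply]
          simp [f', hq0]
        · rw [Function.extend_apply' _ _ _ h, Function.extend_apply' _ _ _ h]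
          simp [g', hi]
    have hswap : exchangeMatrix f g (exchangeSet p q) = fun x =>
        exchangeMatrix f' g' (exchangeSet (fun k : Fin t => p k.succ) fun k => q k.succ)
          (Equiv.swap (Sum.inl (q 0)) (Sum.inr (p 0)) x) := by
      funext x
      rcases x with i | i
      · by_cases hi : i = q 0
        · subst hi
          simp [exchangeMatrix, hp0, g']
        · have hne : Equiv.swap (Sum.inl (q 0)) (Sum.inr (p 0)) (Sum.inl i) =
              (Sum.inl i : ι ⊕ ι) := Equiv.swap_apply_of_ne_of_ne (by simpa using hi) (by simp)
          simp [exchangeMatrix, hne, Fin.exists_fin_succ, f', hi, Ne.symm hi]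
      · by_cases hi : i = p 0
        · subst hi
          simp [exchangeMatrix, hq0, f']
        · have hne : Equiv.swap (Sum.inl (q 0)) (Sum.inr (p 0)) (Sum.inr i) =
              (Sum.inr i : ι ⊕ ι) := Equiv.swap_apply_of_ne_of_ne (by simp) (by simpa using hi)
          simp [exchangeMatrix, hne, Fin.exists_fin_succ, g', hi, Ne.symm hi]
    rw [hswap, rowDet_comp_perm, Equiv.Perm.sign_swap (by simp), ih hp' hq', hfg, hgf]
    simp [pow_succ]

end Exchange

/-! ### Sums over nested pairs of sequences -/

theorem mem_nestedPairs {n d t : ℕ} {x : (Fin t → ℕ) × (Fin t → ℕ)} :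
    x ∈ nestedPairs n d t ↔ (∀ k, 1 ≤ x.1 k ∧ x.1 k ≤ d) ∧ (∀ k, d ≤ x.2 k ∧ x.2 k ≤ n) ∧
      StrictMono x.1 ∧ StrictAnti x.2 := by
  simp only [nestedPairs, Finset.mem_filter, Finset.mem_product, Fintype.mem_piFinset,
    Finset.mem_Icc, and_assoc]
  rfl

theorem exists_strictMono_fin_of_card (P : Finset ℕ) {t : ℕ} (h : P.card = t) :
    ∃ p : Fin t → ℕ, StrictMono p ∧ ∀ a, a ∈ P ↔ ∃ k, p k = a := by
  refine ⟨P.orderEmbOfFin h, (P.orderEmbOfFin h).strictMono, fun a => ?_⟩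
  have := P.range_orderEmbOfFin h
  rw [← Finset.mem_coe, ← this]
  rfl

theorem strictMono_fin_unique {t : ℕ} {p p' : Fin t → ℕ} (hp : StrictMono p)
    (hp' : StrictMono p') (h : ∀ a, (∃ k, p k = a) ↔ ∃ k, p' k = a) : p = p' :=
  (hp.range_inj hp').1 (Set.ext fun a => h a)

theorem strictAnti_fin_unique {t : ℕ} {q q' : Fin t → ℕ} (hq : StrictAnti q)
    (hq' : StrictAnti q') (h : ∀ a, (∃ k, q k = a) ↔ ∃ k, q' k = a) : q = q' := by
  have key : (fun k => q (Fin.rev k)) = fun k => q' (Fin.rev k) := by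
    refine strictMono_fin_unique (fun a b hab => hq (Fin.rev_lt_rev.2 hab))
      (fun a b hab => hq' (Fin.rev_lt_rev.2 hab)) fun a => ?_
    have := h a
    rwa [Fin.revPerm.surjective.exists (p := fun k => q k = a),
      Fin.revPerm.surjective.exists (p := fun k => q' k = a)] at this
  funext k
  simpa using congrFun key (Fin.rev k)

/-- A set with nonzero term is given by the index sets `P` of its moved rows in `L` and `Q` of those
outside `L`. They have equal size `t`, and listing `P` increasingly and `Q` decreasingly gives a
unique nested pair. -/
theorem sum_exchangeSupport_eq_sum_nestedPairs {ι A : Type*} [Fintype ι] [DecidableEq ι]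
    [AddCommMonoid A] {n d : ℕ} {L : Finset ι} {B T : ℕ → ι}
    (hB : Set.InjOn B (Set.Icc 1 d)) (hBL : ∀ p ∈ Set.Icc 1 d, B p ∈ L)
    (hT : Set.InjOn T (Set.Icc d n)) (hTL : ∀ q ∈ Set.Icc d n, T q ∉ L)
    {F : Finset (ι ⊕ ι) → A}
    (hcard : ∀ s, F s ≠ 0 → (Finset.univ.filter fun i => Sum.inl i ∈ s).card =
      (Finset.univ.filter fun i => Sum.inr i ∈ s).card)
    (hI : ∀ s ⊆ exchangeSupport L, F s ≠ 0 → ∀ i, Sum.inr i ∈ s → ∃ p ∈ Set.Icc 1 d, B p = i)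
    (hJ : ∀ s ⊆ exchangeSupport L, F s ≠ 0 → ∀ i, Sum.inl i ∈ s → ∃ q ∈ Set.Icc d n, T q = i) :
    ∑ s ∈ (exchangeSupport L).powerset, F s =
      ∑ t ∈ Finset.range (min d (n - d + 1) + 1), ∑ x ∈ nestedPairs n d t,
        F (exchangeSet (fun k => B (x.1 k)) fun k => T (x.2 k)) := by
  rw [Finset.sum_sigma']
  symm
  refine Finset.sum_of_injOn
    (fun z : (t : ℕ) × ((Fin t → ℕ) × (Fin t → ℕ)) =>
      exchangeSet (fun k => B (z.2.1 k)) fun k => T (z.2.2 k)) ?_ ?_ ?_ fun _ _ => rfl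
  · rintro ⟨t, p, q⟩ hz ⟨t', p', q'⟩ hz' h
    simp only [Finset.coe_sigma, Set.mem_sigma_iff, Finset.mem_coe, mem_nestedPairs] at hz hz'
    obtain ⟨-, hp, hq, hpm, hqm⟩ := hz
    obtain ⟨-, hp', hq', hpm', hqm'⟩ := hz'
    have hmem : ∀ y, y ∈ exchangeSet (fun k => B (p k)) (fun k => T (q k)) ↔
        y ∈ exchangeSet (fun k => B (p' k)) (fun k => T (q' k)) := Finset.ext_iff.1 h
    have hpp : ∀ a, (∃ k, p k = a) ↔ ∃ k, p' k = a := by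
      intro a
      constructor
      · rintro ⟨k, rfl⟩
        obtain ⟨k', hk'⟩ := inr_mem_exchangeSet.1
          ((hmem (Sum.inr (B (p k)))).1 (inr_mem_exchangeSet.2 ⟨k, rfl⟩))
        exact ⟨k', hB (hp' k') (hp k) hk'⟩
      · rintro ⟨k, rfl⟩
        obtain ⟨k', hk'⟩ := inr_mem_exchangeSet.1
          ((hmem (Sum.inr (B (p' k)))).2 (inr_mem_exchangeSet.2 ⟨k, rfl⟩))
        exact ⟨k', hB (hp k') (hp' k) hk'⟩
    have hqq : ∀ a, (∃ k, q k = a) ↔ ∃ k, q' k = a := by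
      intro a
      constructor
      · rintro ⟨k, rfl⟩
        obtain ⟨k', hk'⟩ := inl_mem_exchangeSet.1
          ((hmem (Sum.inl (T (q k)))).1 (inl_mem_exchangeSet.2 ⟨k, rfl⟩))
        exact ⟨k', hT (hq' k') (hq k) hk'⟩
      · rintro ⟨k, rfl⟩
        obtain ⟨k', hk'⟩ := inl_mem_exchangeSet.1
          ((hmem (Sum.inl (T (q' k)))).2 (inl_mem_exchangeSet.2 ⟨k, rfl⟩))
        exact ⟨k', hT (hq k') (hq' k) hk'⟩
    have ht : t = t' := by
      have h1 : Finset.univ.image p = Finset.univ.image p' := by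
        ext a
        simpa using hpp a
      have h2 := congrArg Finset.card h1
      rwa [Finset.card_image_of_injective _ hpm.injective,
        Finset.card_image_of_injective _ hpm'.injective, Finset.card_fin, Finset.card_fin] at h2
    subst ht
    obtain rfl := strictMono_fin_unique hpm hpm' hpp
    obtain rfl := strictAnti_fin_unique hqm hqm' hqq
    rfl
  · rintro ⟨t, p, q⟩ hz
    simp only [Finset.coe_sigma, Set.mem_sigma_iff, Finset.mem_coe, mem_nestedPairs] at hz
    obtain ⟨-, hp, hq, hpm, hqm⟩ := hz
    simp only [Finset.coe_powerset, Set.mem_preimage, Set.mem_powerset_iff, Finset.coe_subset]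
    rintro (i | i) hi
    · obtain ⟨k, rfl⟩ := inl_mem_exchangeSet.1 hi
      exact inl_mem_exchangeSupport.2 (hTL _ (hq k))
    · obtain ⟨k, rfl⟩ := inr_mem_exchangeSet.1 hi
      exact inr_mem_exchangeSupport.2 (hBL _ (hp k))
  · intro s hs hns
    rw [Finset.mem_powerset] at hs
    by_contra hF
    refine hns ?_
    let P := (Finset.Icc 1 d).filter fun p => Sum.inr (B p) ∈ s
    let Q := (Finset.Icc d n).filter fun q => Sum.inl (T q) ∈ s
    have hPi : P.image B = Finset.univ.filter fun i => Sum.inr i ∈ s := by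
      ext i
      simp only [P, Finset.mem_image, Finset.mem_filter, Finset.mem_univ, true_and]
      constructor
      · rintro ⟨p, ⟨-, hp⟩, rfl⟩
        exact hp
      · intro hi
        obtain ⟨p, hp, rfl⟩ := hI s hs hF i hi
        exact ⟨p, ⟨Finset.mem_Icc.2 hp, hi⟩, rfl⟩
    have hQi : Q.image T = Finset.univ.filter fun i => Sum.inl i ∈ s := by
      ext i
      simp only [Q, Finset.mem_image, Finset.mem_filter, Finset.mem_univ, true_and]
      constructor
      · rintro ⟨p, ⟨-, hp⟩, rfl⟩
        exact hp
      · intro hi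
        obtain ⟨p, hp, rfl⟩ := hJ s hs hF i hi
        exact ⟨p, ⟨Finset.mem_Icc.2 hp, hi⟩, rfl⟩
    have hPQ : Q.card = P.card := by
      rw [← Finset.card_image_of_injOn (s := P) (f := B),
        ← Finset.card_image_of_injOn (s := Q) (f := T), hPi, hQi, hcard s hF]
      · exact hT.mono fun q hq => Finset.mem_Icc.1 (Finset.mem_filter.1 hq).1
      · exact hB.mono fun p hp => Finset.mem_Icc.1 (Finset.mem_filter.1 hp).1
    obtain ⟨p, hpm, hpP⟩ := exists_strictMono_fin_of_card P rfl
    obtain ⟨q, hqm, hqQ⟩ := exists_strictMono_fin_of_card Q hPQ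
    have hPd : P.card ≤ d := (Finset.card_filter_le _ _).trans (by simp)
    have hQd : Q.card ≤ n - d + 1 := (Finset.card_filter_le _ _).trans (by simp; omega)
    have hpmem : ∀ k, p k ∈ P := fun k => (hpP _).2 ⟨k, rfl⟩
    have hqmem : ∀ k, q k ∈ Q := fun k => (hqQ _).2 ⟨k, rfl⟩
    -- `q` lists `Q` increasingly, whereas nested pairs want it decreasing.
    refine ⟨⟨P.card, p, fun k => q (Fin.rev k)⟩, ?_, ?_⟩
    · simp only [Finset.coe_sigma, Set.mem_sigma_iff, Finset.mem_coe, mem_nestedPairs,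
        Finset.mem_range]
      refine ⟨by omega, fun k => ?_, fun k => ?_, hpm, fun a b hab => hqm (Fin.rev_lt_rev.2 hab)⟩
      · exact Finset.mem_Icc.1 (Finset.mem_filter.1 (hpmem k)).1
      · exact Finset.mem_Icc.1 (Finset.mem_filter.1 (hqmem _)).1
    · ext x
      rcases x with i | i
      · simp only [inl_mem_exchangeSet]
        constructor
        · rintro ⟨k, rfl⟩
          exact (Finset.mem_filter.1 (hqmem _)).2
        · intro hi
          obtain ⟨a, ha, rfl⟩ := hJ s hs hF i hi
          obtain ⟨k, rfl⟩ := (hqQ a).1 (Finset.mem_filter.2 ⟨Finset.mem_Icc.2 ha, hi⟩)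
          exact ⟨Fin.rev k, by rw [Fin.rev_rev]⟩
      · simp only [inr_mem_exchangeSet]
        constructor
        · rintro ⟨k, rfl⟩
          exact (Finset.mem_filter.1 (hpmem _)).2
        · intro hi
          obtain ⟨a, ha, rfl⟩ := hI s hs hF i hi
          obtain ⟨k, rfl⟩ := (hpP a).1 (Finset.mem_filter.2 ⟨Finset.mem_Icc.2 ha, hi⟩)
          exact ⟨k, rfl⟩

/-! ### Young diagrams and their row lengths -/

theorem youngDiagram_ext_rowLen {μ ν : YoungDiagram} (h : ∀ i, μ.rowLen i = ν.rowLen i) :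
    μ = ν := by
  ext ⟨i, j⟩
  simp only [YoungDiagram.mem_cells, YoungDiagram.mem_iff_lt_rowLen, h]

theorem rowLen_eq_of_mem_iff {μ : YoungDiagram} {i m : ℕ} (h : ∀ j, (i, j) ∈ μ ↔ j < m) :
    μ.rowLen i = m := by
  refine le_antisymm ?_ ?_
  · by_contra hlt
    exact lt_irrefl m ((h m).1 (YoungDiagram.mem_iff_lt_rowLen.2 (by omega)))
  · by_contra hlt
    exact lt_irrefl _ (YoungDiagram.mem_iff_lt_rowLen.1 ((h (μ.rowLen i)).2 (by omega)))

theorem rowLen_eq_zero_iff {μ : YoungDiagram} {i : ℕ} : μ.rowLen i = 0 ↔ μ.colLen 0 ≤ i := by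
  have h1 : (i, 0) ∈ μ ↔ 0 < μ.rowLen i := YoungDiagram.mem_iff_lt_rowLen
  have h2 : (i, 0) ∈ μ ↔ i < μ.colLen 0 := YoungDiagram.mem_iff_lt_colLen
  rw [h2] at h1
  omega

theorem ofCells_eq_some {s : Finset (ℕ × ℕ)} {w : ℕ → ℕ} (hw : Antitone w)
    (hs : ∀ i j, (i, j) ∈ s ↔ j < w i) :
    ∃ μ, ofCells s = some μ ∧ ∀ i, μ.rowLen i = w i := by
  have hl : IsLowerSet (s : Set (ℕ × ℕ)) := by
    rintro ⟨i, j⟩ ⟨i', j'⟩ ⟨hi, hj⟩ h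
    rw [Finset.mem_coe, hs] at h ⊢
    exact (lt_of_le_of_lt hj h).trans_le (hw hi)
  exact ⟨⟨s, hl⟩, by rw [ofCells, dif_pos hl], fun i => rowLen_eq_of_mem_iff fun j => hs i j⟩

theorem exists_youngDiagram_rowLen {w : ℕ → ℕ} (hw : Antitone w) {N : ℕ} (hN : w N = 0) :
    ∃ μ : YoungDiagram, ∀ i, μ.rowLen i = w i := by
  obtain ⟨μ, -, hμ⟩ := ofCells_eq_some (s := (Finset.range N).sigma (fun i => Finset.range (w i))
    |>.image fun z => (z.1, z.2)) hw (by
      intro i j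
      simp only [Finset.mem_image, Finset.mem_sigma, Finset.mem_range, Prod.mk.injEq]
      constructor
      · rintro ⟨⟨i', j'⟩, ⟨-, h⟩, rfl, rfl⟩
        exact h
      · intro h
        refine ⟨⟨i, j⟩, ⟨?_, h⟩, rfl, rfl⟩
        by_contra hi
        have : w i ≤ w N := hw (not_lt.1 hi)
        omega)
  exact ⟨μ, hμ⟩

/-- The list of row lengths stops at the last nonempty row; `h0` makes the formula agree with the
length `0` beyond it. -/
theorem ofRows_mapIdx_rowLens (lam : YoungDiagram) (f : ℕ → ℕ → ℕ)
    (h0 : ∀ i, lam.colLen 0 ≤ i → f i 0 = 0) (hf : Antitone fun i => f i (lam.rowLen i)) :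
    ∃ μ, ofRows (lam.rowLens.mapIdx f) = some μ ∧ ∀ i, μ.rowLen i = f i (lam.rowLen i) := by
  have hw : (lam.rowLens.mapIdx f).SortedGE := by
    refine List.sortedGE_of_getElem_ge_getElem_of_le ?_
    intro i j hi hj hij
    simp only [List.getElem_mapIdx, YoungDiagram.get_rowLens]
    exact hf hij
  refine ⟨_, by rw [ofRows, dif_pos hw], fun i => rowLen_eq_of_mem_iff fun j => ?_⟩
  rw [YoungDiagram.mem_ofRowLens]
  simp only [List.length_mapIdx, YoungDiagram.length_rowLens, List.getElem_mapIdx,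
    YoungDiagram.get_rowLens]
  constructor
  · rintro ⟨-, h⟩
    exact h
  · intro h
    refine ⟨?_, h⟩
    by_contra hi
    rw [rowLen_eq_zero_iff.2 (not_lt.1 hi), h0 i (not_lt.1 hi)] at h
    omega

theorem addOnes_eq_some (lam : YoungDiagram) {l : ℕ} (hl : l ≤ lam.colLen 0) :
    ∃ μ, addOnes lam l = some μ ∧
      ∀ i, μ.rowLen i = if i < l then lam.rowLen i + 1 else lam.rowLen i := by
  refine ofRows_mapIdx_rowLens lam (fun i x => if i < l then x + 1 else x) ?_ ?_
  · intro i hi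
    rw [if_neg (by omega)]
  · intro i j hij
    have := lam.rowLen_anti i j hij
    dsimp only
    split_ifs <;> omega

theorem subOnes_eq_some (lam : YoungDiagram) {l : ℕ}
    (hl : lam.rowLen l < lam.rowLen (l - 1)) :
    ∃ μ, subOnes lam l = some μ ∧
      ∀ i, μ.rowLen i = if i < l then lam.rowLen i - 1 else lam.rowLen i := by
  refine ofRows_mapIdx_rowLens lam (fun i x => if i < l then x - 1 else x) ?_ ?_
  · intro i hi
    simp
  · intro i j hij
    have := lam.rowLen_anti i j hij
    dsimp only
    split_ifs with h1 h2 h2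
    · omega
    · omega
    · have h3 := lam.rowLen_anti l j (by omega)
      have h4 := lam.rowLen_anti i (l - 1) (by omega)
      omega
    · omega

/-! ### Border strips in terms of row lengths. -/

theorem mem_outsideBorder {lam : YoungDiagram} {i j : ℕ} :
    (i, j) ∈ outsideBorder lam ↔ lam.rowLen i ≤ j ∧
      ((1 ≤ i ∧ j < lam.rowLen (i - 1)) ∨ (1 ≤ j ∧ j ≤ lam.rowLen i) ∨
        (1 ≤ i ∧ 1 ≤ j ∧ j ≤ lam.rowLen (i - 1))) := by
  simp only [outsideBorder, Finset.mem_sdiff, Finset.mem_union, Finset.mem_image,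
    YoungDiagram.mem_cells, Prod.exists, Prod.mk.injEq, YoungDiagram.mem_iff_lt_rowLen, not_lt,
    or_assoc]
  rw [and_comm]
  refine and_congr_right fun hij => or_congr ?_ (or_congr ?_ ?_)
  · constructor
    · rintro ⟨a, b, h, rfl, rfl⟩
      simpa using h
    · rintro ⟨h1, h2⟩
      exact ⟨i - 1, j, h2, by omega, rfl⟩
  · constructor
    · rintro ⟨a, b, h, rfl, rfl⟩
      omega
    · rintro ⟨h1, h2⟩
      exact ⟨i, j - 1, by omega, rfl, by omega⟩
  · constructor
    · rintro ⟨a, b, h, rfl, rfl⟩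
      simpa using h
    · rintro ⟨h1, h2, h3⟩
      exact ⟨i - 1, j - 1, by omega, by omega, by omega⟩

theorem mem_insideBorder {lam : YoungDiagram} {i j : ℕ} :
    (i, j) ∈ insideBorder lam ↔ j < lam.rowLen i ∧ lam.rowLen (i + 1) ≤ j + 1 := by
  simp only [insideBorder, Finset.mem_filter, YoungDiagram.mem_cells,
    YoungDiagram.mem_iff_lt_rowLen, not_lt]

/-- The outside border is the inside border moved one step down the diagonal, so below its first row
the strip extends each row to the previous length plus one. In terms of `ν_r - r` this shifts the
values down by one row. -/
theorem addStrip_eq_some {ν : YoungDiagram} {i j c : ℕ} (hi : 1 ≤ i) (hij : i ≤ j)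
    (hc : ν.rowLen i ≤ c) (hc' : c < ν.rowLen (i - 1)) (hj : 0 < ν.rowLen (j - 1)) :
    ∃ μ, addStrip (i, c) (j, ν.rowLen j) ν = some μ ∧
      ∀ r, μ.rowLen r =
        if r = i then c + 1 else if i < r ∧ r ≤ j then ν.rowLen (r - 1) + 1 else ν.rowLen r := by
  have hu : (i, c) ∈ outsideBorder ν := by
    rw [mem_outsideBorder]
    exact ⟨hc, Or.inl ⟨hi, hc'⟩⟩
  have hv : (j, ν.rowLen j) ∈ outsideBorder ν := by
    rw [mem_outsideBorder]
    have := ν.rowLen_anti (j - 1) j (by omega)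
    refine ⟨le_rfl, ?_⟩
    omega
  rw [addStrip, if_pos ⟨hu, hv⟩]
  refine ofCells_eq_some ?_ ?_
  · refine antitone_nat_of_succ_le fun r => ?_
    have h1 := ν.rowLen_anti r (r + 1) (by omega)
    have h2 := ν.rowLen_anti (r - 1) r (by omega)
    simp only [Nat.add_sub_cancel]
    by_cases hr : r + 1 = i
    · subst hr
      simp only [Nat.add_sub_cancel] at hc'
      rw [if_pos rfl, if_neg (by omega), if_neg (by omega)]
      omega
    · rw [if_neg hr]
      by_cases hr' : r = i
      · subst hr'
        simp only [if_true]
        split_ifs <;> omega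
      · rw [if_neg hr']
        split_ifs <;> omega
  · intro r x
    simp only [Finset.mem_union, YoungDiagram.mem_cells, YoungDiagram.mem_iff_lt_rowLen, substrip,
      Finset.mem_filter, mem_outsideBorder]
    by_cases hr : r = i
    · subst hr
      have := ν.rowLen_anti r j hij
      simp only [if_true]
      omega
    · rw [if_neg hr]
      by_cases hr' : i < r ∧ r ≤ j
      · rw [if_pos hr']
        have h1 := ν.rowLen_anti i (r - 1) (by omega)
        have h2 := ν.rowLen_anti (r - 1) r (by omega)
        have h3 := ν.rowLen_anti r j (by omega)
        have h4 := ν.rowLen_anti (r - 1) (j - 1) (by omega)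
        omega
      · rw [if_neg hr']
        omega

/-- Dually, above its last row the strip cuts each row to the next length minus one, so the values
`ν_r - r` move up by one row. -/
theorem remStrip_eq_some {ν : YoungDiagram} {i j c : ℕ} (hij : i ≤ j)
    (hc : ν.rowLen (j + 1) ≤ c) (hc' : c < ν.rowLen j) :
    ∃ μ, remStrip (i, ν.rowLen i - 1) (j, c) ν = some μ ∧
      ∀ r, μ.rowLen r =
        if r = j then c else if i ≤ r ∧ r < j then ν.rowLen (r + 1) - 1 else ν.rowLen r := by
  have hji := ν.rowLen_anti i j hij
  have hi := ν.rowLen_anti i (i + 1) (by omega)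
  have hu : (i, ν.rowLen i - 1) ∈ insideBorder ν := by
    rw [mem_insideBorder]
    omega
  have hv : (j, c) ∈ insideBorder ν := by
    rw [mem_insideBorder]
    omega
  rw [remStrip, if_pos ⟨hu, hv⟩]
  refine ofCells_eq_some ?_ ?_
  · refine antitone_nat_of_succ_le fun r => ?_
    have h1 := ν.rowLen_anti r (r + 1) (by omega)
    have h2 := ν.rowLen_anti (r + 1) (r + 1 + 1) (by omega)
    by_cases hr : r = j
    · subst hr
      rw [if_neg (by omega), if_neg (by omega), if_pos rfl]
      exact hc
    · rw [if_neg hr]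
      by_cases hr' : r + 1 = j
      · subst hr'
        simp only [if_true]
        split_ifs <;> omega
      · rw [if_neg hr']
        split_ifs <;> omega
  · intro r x
    simp only [Finset.mem_sdiff, YoungDiagram.mem_cells, YoungDiagram.mem_iff_lt_rowLen, substrip,
      Finset.mem_filter, mem_insideBorder]
    by_cases hr : r = j
    · subst hr
      simp only [if_true]
      omega
    · rw [if_neg hr]
      by_cases hr' : i ≤ r ∧ r < j
      · rw [if_pos hr']
        have h1 := ν.rowLen_anti i r (by omega)
        have h2 := ν.rowLen_anti r (r + 1) (by omega)
        have h3 := ν.rowLen_anti (r + 1) j (by omega)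
        omega
      · rw [if_neg hr']
        omega

/-! ### Generating functions of tableaux with diagonally constant weights -/

/-- The sum of the weights of the tableaux of shape `lam` with entries in `{1, …, M}`, where an
entry `t` in a box of content `c` has the weight `x t c`. -/
noncomputable def tableauSum (x : ℕ → ℤ → ℂ) (M : ℕ) (lam : YoungDiagram) : ℂ :=
  ∑ T ∈ (truncSSYT_finite M lam).toFinset, ∏ c ∈ lam.cells, x (T c.1 c.2) (content c)

theorem diagZeta_some_eq_tableauSum (M : ℕ) (lam : YoungDiagram) (a : ℤ → ℂ) :
    diagZeta M (some lam) a = tableauSum (fun t c => (t : ℂ) ^ (-(a c))) M lam :=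
  Finset.sum_congr rfl fun T _ =>
    Finset.prod_coe_sort lam.cells fun c => ((T c.1 c.2 : ℕ) : ℂ) ^ (-(a (content c)))

theorem tableauSum_zero (x : ℕ → ℤ → ℂ) (lam : YoungDiagram) :
    tableauSum x 0 lam = if lam.rowLen 0 = 0 then 1 else 0 := by
  split_ifs with h
  · have hc : ∀ i j, (i, j) ∉ lam := by
      intro i j hij
      have h1 := lam.rowLen_anti 0 i (Nat.zero_le i)
      have h2 := YoungDiagram.mem_iff_lt_rowLen.1 hij
      omega
    have hcells : lam.cells = ∅ := by
      ext ⟨i, j⟩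
      simpa using hc i j
    have hT : (truncSSYT_finite 0 lam).toFinset = {SemistandardYoungTableau.highestWeight lam} := by
      ext T
      simp only [Set.Finite.mem_toFinset, truncSSYT, hcells, Set.mem_ofPred_eq, Finset.notMem_empty,
        false_imp_iff, implies_true, Finset.mem_singleton, true_iff]
      ext i j
      rw [T.zeros (hc i j), SemistandardYoungTableau.zeros _ (hc i j)]
    rw [tableauSum, hT, Finset.sum_singleton, hcells, Finset.prod_empty]
  · have hT : (truncSSYT_finite 0 lam).toFinset = ∅ := by
      ext T
      simp only [Set.Finite.mem_toFinset, Finset.notMem_empty, iff_false]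
      intro hT
      have := hT (0, 0) ((lam.mem_cells _).2 (YoungDiagram.mem_iff_lt_rowLen.2 (by omega)))
      omega
    rw [tableauSum, hT, Finset.sum_empty]

/-! ### Recursion on the largest entry. -/

theorem horizontalStrips_finite (lam : YoungDiagram) :
    {μ : YoungDiagram | μ ≤ lam ∧ ∀ i j, (i + 1, j) ∈ lam → (i, j) ∈ μ}.Finite := by
  refine Set.Finite.of_finite_image (f := YoungDiagram.cells) ?_ ?_
  · refine (lam.cells.powerset : Set (Finset (ℕ × ℕ))).toFinite.subset ?_
    rintro _ ⟨μ, hμ, rfl⟩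
    simpa using hμ.1
  · intro μ _ ν _ h
    exact YoungDiagram.ext h

/-- The diagrams `μ` such that `lam / μ` is a horizontal strip. -/
noncomputable def horizontalStrips (lam : YoungDiagram) : Finset YoungDiagram :=
  (horizontalStrips_finite lam).toFinset

theorem mem_horizontalStrips {lam μ : YoungDiagram} :
    μ ∈ horizontalStrips lam ↔ μ ≤ lam ∧ ∀ i j, (i + 1, j) ∈ lam → (i, j) ∈ μ := by
  simp [horizontalStrips]

/-- The tableau of shape `lam` which extends the tableau `S` of shape `μ` by entries `M + 1`. -/
def extendTableau {M : ℕ} {lam μ : YoungDiagram}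
    (hle : μ ≤ lam) (hstrip : ∀ i j, (i + 1, j) ∈ lam → (i, j) ∈ μ)
    (S : SemistandardYoungTableau μ) (hS : S ∈ truncSSYT M μ) : SemistandardYoungTableau lam where
  entry i j := if (i, j) ∈ μ then S i j else if (i, j) ∈ lam then M + 1 else 0
  row_weak' := by
    intro i j1 j2 hj h2
    have h1 : (i, j1) ∈ lam := lam.up_left_mem le_rfl hj.le h2
    by_cases h2' : (i, j2) ∈ μ
    · rw [if_pos h2', if_pos (μ.up_left_mem le_rfl hj.le h2')]
      exact S.row_weak hj h2'
    · rw [if_neg h2', if_pos h2]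
      split_ifs with h
      · exact (hS (i, j1) ((μ.mem_cells _).2 h)).2.trans (Nat.le_succ M)
      · exact le_rfl
  col_strict' := by
    intro i1 i2 j hi h2
    have h1 : (i1, j) ∈ μ := hstrip i1 j (lam.up_left_mem hi le_rfl h2)
    rw [if_pos h1]
    by_cases h2' : (i2, j) ∈ μ
    · rw [if_pos h2']
      exact S.col_strict hi h2'
    · rw [if_neg h2', if_pos h2]
      exact Nat.lt_succ_of_le (hS (i1, j) ((μ.mem_cells _).2 h1)).2
  zeros' := by
    intro i j h
    rw [if_neg (fun h' => h (hle h')), if_neg h]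

theorem extendTableau_apply {M : ℕ} {lam μ : YoungDiagram}
    (hle : μ ≤ lam) (hstrip : ∀ i j, (i + 1, j) ∈ lam → (i, j) ∈ μ)
    (S : SemistandardYoungTableau μ) (hS : S ∈ truncSSYT M μ) (i j : ℕ) :
    extendTableau hle hstrip S hS i j =
      if (i, j) ∈ μ then S i j else if (i, j) ∈ lam then M + 1 else 0 := rfl

/-- Deleting the entries `M + 1` is a bijection onto tableaux of smaller shape with entries at most
`M`. Columns are strict, so the deleted boxes form a horizontal strip. -/
theorem tableauSum_succ (x : ℕ → ℤ → ℂ) (M : ℕ) (lam : YoungDiagram) :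
    tableauSum x (M + 1) lam = ∑ μ ∈ horizontalStrips lam,
      tableauSum x M μ * ∏ c ∈ lam.cells \ μ.cells, x (M + 1) (content c) := by
  simp only [tableauSum, Finset.sum_mul]
  rw [Finset.sum_sigma']
  symm
  have hmem : ∀ z : (μ : YoungDiagram) × SemistandardYoungTableau μ,
      z ∈ (horizontalStrips lam).sigma (fun μ => (truncSSYT_finite M μ).toFinset) →
      (z.1 ≤ lam ∧ ∀ i j, (i + 1, j) ∈ lam → (i, j) ∈ z.1) ∧ z.2 ∈ truncSSYT M z.1 := by
    intro z hz
    rw [Finset.mem_sigma, mem_horizontalStrips, Set.Finite.mem_toFinset] at hz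
    exact hz
  refine Finset.sum_bij (fun z hz => extendTableau (hmem z hz).1.1 (hmem z hz).1.2 z.2 (hmem z hz).2)
    ?_ ?_ ?_ ?_
  · intro z hz
    obtain ⟨⟨hle, hstrip⟩, hS⟩ := hmem z hz
    rw [Set.Finite.mem_toFinset]
    rintro ⟨i, j⟩ hij
    rw [YoungDiagram.mem_cells] at hij
    dsimp only
    rw [extendTableau_apply]
    split_ifs with h
    · have := hS (i, j) ((z.1.mem_cells _).2 h)
      exact ⟨this.1, this.2.trans (Nat.le_succ M)⟩
    · exact ⟨Nat.succ_pos M, le_rfl⟩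
  · intro z hz z' hz' h
    obtain ⟨⟨hle, hstrip⟩, hS⟩ := hmem z hz
    obtain ⟨⟨hle', hstrip'⟩, hS'⟩ := hmem z' hz'
    have happ : ∀ i j, (if (i, j) ∈ z.1 then z.2 i j else if (i, j) ∈ lam then M + 1 else 0) =
        if (i, j) ∈ z'.1 then z'.2 i j else if (i, j) ∈ lam then M + 1 else 0 := by
      intro i j
      rw [← extendTableau_apply hle hstrip z.2 hS, ← extendTableau_apply hle' hstrip' z'.2 hS']
      rw [h]
    obtain ⟨μ, S⟩ := z
    obtain ⟨μ', S'⟩ := z'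
    dsimp only at *
    have hμ : μ = μ' := by
      ext ⟨i, j⟩
      simp only [YoungDiagram.mem_cells]
      have := happ i j
      constructor
      · intro h1
        by_contra h2
        rw [if_pos h1, if_neg h2, if_pos (hle h1)] at this
        have := (hS (i, j) ((μ.mem_cells _).2 h1)).2
        dsimp only at this
        omega
      · intro h1
        by_contra h2
        rw [if_pos h1, if_neg h2, if_pos (hle' h1)] at this
        have := (hS' (i, j) ((μ'.mem_cells _).2 h1)).2
        dsimp only at this
        omega
    subst hμ
    congr 1
    ext i j
    by_cases hij : (i, j) ∈ μ
    · simpa [hij] using happ i j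
    · rw [S.zeros hij, S'.zeros hij]
  · intro T hT
    rw [Set.Finite.mem_toFinset] at hT
    -- The inverse map: the boxes with entries at most `M` form a diagram, as entries increase along
    -- rows and columns.
    let μ : YoungDiagram := ⟨lam.cells.filter fun c => T c.1 c.2 ≤ M, by
      rintro ⟨i, j⟩ ⟨i', j'⟩ ⟨hi, hj⟩ h
      simp only [Finset.coe_filter, Set.mem_ofPred_eq, YoungDiagram.mem_cells] at h ⊢
      dsimp only at hi hj
      have h1 : (i', j) ∈ lam := lam.up_left_mem hi le_rfl h.1
      exact ⟨lam.up_left_mem hi hj h.1,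
        (T.row_weak_of_le hj h1).trans ((T.col_weak hi h.1).trans h.2)⟩⟩
    have hμ : ∀ i j, (i, j) ∈ μ ↔ (i, j) ∈ lam ∧ T i j ≤ M := by
      intro i j
      rw [← YoungDiagram.mem_cells]
      simp [μ]
    let S : SemistandardYoungTableau μ :=
      { entry := fun i j => if (i, j) ∈ μ then T i j else 0
        row_weak' := by
          intro i j1 j2 hj h
          rw [if_pos h, if_pos (μ.up_left_mem le_rfl hj.le h)]
          exact T.row_weak hj ((hμ _ _).1 h).1
        col_strict' := by
          intro i1 i2 j hi h
          rw [if_pos h, if_pos (μ.up_left_mem hi.le le_rfl h)]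
          exact T.col_strict hi ((hμ _ _).1 h).1
        zeros' := fun h => if_neg h }
    have hSapp : ∀ i j, S i j = if (i, j) ∈ μ then T i j else 0 := fun _ _ => rfl
    have hle : μ ≤ lam := fun c hc => ((hμ c.1 c.2).1 hc).1
    have hstrip : ∀ i j, (i + 1, j) ∈ lam → (i, j) ∈ μ := by
      intro i j hij
      rw [hμ]
      have h1 : T i j < T (i + 1) j := T.col_strict (Nat.lt_succ_self i) hij
      have h2 := (hT (i + 1, j) ((lam.mem_cells _).2 hij)).2
      exact ⟨lam.up_left_mem (Nat.le_succ i) le_rfl hij, by dsimp only at h2; omega⟩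
    have hS : S ∈ truncSSYT M μ := by
      rintro ⟨i, j⟩ hij
      rw [YoungDiagram.mem_cells] at hij
      dsimp only
      rw [hSapp, if_pos hij]
      exact ⟨(hT (i, j) ((lam.mem_cells _).2 ((hμ i j).1 hij).1)).1, ((hμ i j).1 hij).2⟩
    refine ⟨⟨μ, S⟩, ?_, ?_⟩
    · rw [Finset.mem_sigma, mem_horizontalStrips, Set.Finite.mem_toFinset]
      exact ⟨⟨hle, hstrip⟩, hS⟩
    · ext i j
      rw [extendTableau_apply]
      split_ifs with h1 h2
      · rw [hSapp, if_pos h1]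
      · have h3 := (hT (i, j) ((lam.mem_cells _).2 h2)).2
        have h4 : ¬ T i j ≤ M := fun h => h1 ((hμ i j).2 ⟨h2, h⟩)
        dsimp only at h3
        omega
      · rw [T.zeros h2]
  · intro z hz
    obtain ⟨⟨hle, hstrip⟩, hS⟩ := hmem z hz
    rw [← Finset.prod_sdiff (YoungDiagram.cells_subset_iff.2 hle), mul_comm]
    congr 1
    · refine Finset.prod_congr rfl ?_
      rintro ⟨i, j⟩ hij
      rw [Finset.mem_sdiff, YoungDiagram.mem_cells, YoungDiagram.mem_cells] at hij
      dsimp only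
      rw [extendTableau_apply, if_neg hij.2, if_pos hij.1]
    · refine Finset.prod_congr rfl ?_
      rintro ⟨i, j⟩ hij
      rw [YoungDiagram.mem_cells] at hij
      dsimp only
      rw [extendTableau_apply, if_pos hij]

/-- The contents in one row of a skew shape form an interval; this puts the weight of a strip in the
shape of the row coefficients of the determinants. -/
theorem prod_content_sdiff {lam μ : YoungDiagram} {N : ℕ} (hN : lam.colLen 0 ≤ N) (F : ℤ → ℂ) :
    ∏ c ∈ lam.cells \ μ.cells, F (content c) =
      ∏ i : Fin N, ∏ c ∈ Finset.Ico ((μ.rowLen i : ℤ) - i) ((lam.rowLen i : ℤ) - i), F c := by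
  rw [Finset.prod_sigma']
  symm
  refine Finset.prod_nbij
    (fun z : (_ : Fin N) × ℤ => ((z.1 : ℕ), (z.2 + (z.1 : ℕ)).toNat)) ?_ ?_ ?_ ?_
  · rintro ⟨i, c⟩ h
    simp only [Finset.mem_sigma, Finset.mem_univ, true_and, Finset.mem_Ico] at h
    simp only [Finset.mem_sdiff, YoungDiagram.mem_cells, YoungDiagram.mem_iff_lt_rowLen]
    omega
  · rintro ⟨i, c⟩ h ⟨i', c'⟩ h' heq
    simp only [Finset.coe_sigma, Set.mem_sigma_iff, Finset.coe_univ, Set.mem_univ, true_and,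
      Finset.coe_Ico, Set.mem_Ico] at h h'
    simp only [Prod.mk.injEq] at heq
    obtain ⟨h1, h2⟩ := heq
    obtain rfl := Fin.ext h1
    obtain rfl : c = c' := by omega
    rfl
  · rintro ⟨i, j⟩ h
    simp only [Finset.coe_sdiff, Set.mem_sdiff, Finset.mem_coe, YoungDiagram.mem_cells,
      YoungDiagram.mem_iff_lt_rowLen] at h
    have hi : i < N := by
      by_contra hi
      have := rowLen_eq_zero_iff.2 (show lam.colLen 0 ≤ i by omega)
      omega
    refine ⟨⟨⟨i, hi⟩, (j : ℤ) - i⟩, ?_, ?_⟩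
    · simp only [Finset.coe_sigma, Set.mem_sigma_iff, Finset.coe_univ, Set.mem_univ, true_and,
        Finset.coe_Ico, Set.mem_Ico]
      omega
    · simp
  · rintro ⟨i, c⟩ h
    simp only [Finset.mem_sigma, Finset.mem_univ, true_and, Finset.mem_Ico] at h
    congr 1
    simp only [content]
    omega

theorem prod_content_sdiff_transpose (lam μ : YoungDiagram) (F : ℤ → ℂ) :
    ∏ c ∈ lam.transpose.cells \ μ.transpose.cells, F (-content c) =
      ∏ c ∈ lam.cells \ μ.cells, F (content c) := by
  refine Finset.prod_nbij' Prod.swap Prod.swap ?_ ?_ ?_ ?_ ?_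
  · rintro ⟨i, j⟩
    simp
  · rintro ⟨i, j⟩
    simp
  · simp
  · simp
  · rintro ⟨i, j⟩ -
    simp [content]

/-! ### Determinantal formulas -/

/-- The two matrices differ by a unitriangular factor. -/
theorem rowDet_eq_of_forall_eq_add_smul_next {R : Type*} [CommRing R] {N : ℕ}
    {f g : Fin N → Fin N → R} (w : Fin N → R)
    (hlast : ∀ i : Fin N, (i : ℕ) + 1 = N → f i = g i)
    (hnext : ∀ (i : Fin N) (h : (i : ℕ) + 1 < N), f i = g i + w i • f ⟨i + 1, h⟩) :
    rowDet f = rowDet g := by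
  rcases N with _ | N
  · congr 1
    funext i
    exact i.elim0
  -- Reversing rows and columns turns "next row" into "previous row" and keeps the determinant.
  · have hrev : ∀ u : Fin (N + 1) → Fin (N + 1) → R,
        rowDet u = ((Matrix.of u).submatrix Fin.revPerm Fin.revPerm).det := fun u => by
      rw [Matrix.det_submatrix_equiv_self, rowDet]
    rw [hrev f, hrev g]
    refine Matrix.det_eq_of_forall_row_eq_smul_add_pred (fun i => w (Fin.rev i.succ)) ?_ ?_
    · intro j
      have := hlast (Fin.rev 0) (by simp)
      exact congrFun this (Fin.rev j)
    · intro i j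
      have hi : (Fin.rev i.succ : ℕ) + 1 < N + 1 := by
        rw [Fin.val_rev, Fin.val_succ]
        omega
      have h := hnext (Fin.rev i.succ) hi
      have hr : (⟨(Fin.rev i.succ : ℕ) + 1, hi⟩ : Fin (N + 1)) = Fin.rev i.castSucc := by
        ext
        simp only [Fin.val_rev, Fin.val_succ, Fin.val_castSucc]
        omega
      rw [hr] at h
      simp [h]

theorem rowDet_sum_smul {R α : Type*} [CommRing R] {ι : Type*} [Fintype ι] [DecidableEq ι]
    (S : ι → Finset α) (w : ι → α → R) (v : ι → α → ι → R) :
    rowDet (fun i => ∑ m ∈ S i, w i m • v i m) =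
      ∑ m ∈ Fintype.piFinset S, rowDet (fun i => v i (m i)) * ∏ i, w i (m i) := by
  have h := (Matrix.detRowAlternating (R := R) (n := ι)).toMultilinearMap.map_sum_finset
    (g := fun i m => w i m • v i m) S
  refine Eq.trans h (Finset.sum_congr rfl fun m _ => ?_)
  rw [MultilinearMap.map_smul_univ, smul_eq_mul, mul_comm]
  rfl

/-- The empty shape gives the identity matrix. Otherwise `λ_0 > 0` and the top row is zero, since no
column label is positive. -/
theorem rowDet_single_eq_tableauSum_zero (x : ℕ → ℤ → ℂ) {lam : YoungDiagram} {N : ℕ}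
    (hN : lam.colLen 0 ≤ N) :
    tableauSum x 0 lam =
      rowDet fun i s : Fin N => if (lam.rowLen i : ℤ) - i = -(s : ℕ) then (1 : ℂ) else 0 := by
  rw [tableauSum_zero]
  split_ifs with h
  · have hz : ∀ i, lam.rowLen i = 0 := fun i => by
      have := lam.rowLen_anti 0 i (Nat.zero_le i)
      omega
    have h1 : (Matrix.of fun i s : Fin N =>
        if (lam.rowLen i : ℤ) - i = -(s : ℕ) then (1 : ℂ) else 0) = 1 := by
      ext i s
      simp [hz, Matrix.one_apply, Fin.ext_iff]
    rw [rowDet, h1, Matrix.det_one]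
  · have hpos : 0 < N := by
      by_contra hN0
      exact h (rowLen_eq_zero_iff.2 (by omega))
    refine (Matrix.det_eq_zero_of_row_eq_zero ⟨0, hpos⟩ fun s => ?_).symm
    rw [Matrix.of_apply, if_neg]
    simp only [Nat.cast_zero]
    omega

/-- The weighted complete homogeneous functions: the sum of the weights of the rows of boxes of
contents `s, …, b - 1`, weakly increasing with entries in `{1, …, M}`. -/
noncomputable def hCoeff (x : ℕ → ℤ → ℂ) : ℕ → ℤ → ℤ → ℂ
  | 0, s, b => if b = s then 1 else 0
  | M + 1, s, b => ∑ m ∈ Finset.Icc s b, (∏ c ∈ Finset.Ico m b, x (M + 1) c) * hCoeff x M s m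

theorem hCoeff_eq_zero_of_lt (x : ℕ → ℤ → ℂ) (M : ℕ) {s b : ℤ} (h : b < s) :
    hCoeff x M s b = 0 := by
  cases M with
  | zero => rw [hCoeff, if_neg h.ne]
  | succ M => rw [hCoeff, Finset.Icc_eq_empty (not_le.2 h), Finset.sum_empty]

theorem hCoeff_succ_eq_sum_Icc (x : ℕ → ℤ → ℂ) (M : ℕ) {s b K : ℤ} (hK : K ≤ s) :
    hCoeff x (M + 1) s b =
      ∑ m ∈ Finset.Icc K b, (∏ c ∈ Finset.Ico m b, x (M + 1) c) * hCoeff x M s m := by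
  rw [hCoeff]
  refine Finset.sum_subset (Finset.Icc_subset_Icc_left hK) fun m hm hms => ?_
  rw [Finset.mem_Icc] at hm hms
  rw [hCoeff_eq_zero_of_lt x M (by omega), mul_zero]

/-- The summands with `m < k` share the factor from `[k - 1, b)`, and what remains is again a
complete function, ending at `k - 1`. With `k = λ_{i+1} - i` the end point `k - 1` belongs to the
next row of the Jacobi–Trudi matrix. -/
theorem hCoeff_succ_eq_add (x : ℕ → ℤ → ℂ) (M : ℕ) {s b k : ℤ} (hk : k ≤ b) :
    hCoeff x (M + 1) s b =
      ∑ m ∈ Finset.Icc k b, (∏ c ∈ Finset.Ico m b, x (M + 1) c) * hCoeff x M s m +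
        (∏ c ∈ Finset.Ico (k - 1) b, x (M + 1) c) * hCoeff x (M + 1) s (k - 1) := by
  rw [hCoeff_succ_eq_sum_Icc x M (min_le_left s k), hCoeff_succ_eq_sum_Icc x M (min_le_left s k),
    Finset.mul_sum]
  have hu : Finset.Icc (min s k) b = Finset.Icc (min s k) (k - 1) ∪ Finset.Icc k b := by
    ext m
    simp only [Finset.mem_union, Finset.mem_Icc]
    omega
  have hd : Disjoint (Finset.Icc (min s k) (k - 1)) (Finset.Icc k b) := by
    rw [Finset.disjoint_left]
    intro m
    simp only [Finset.mem_Icc]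
    omega
  rw [hu, Finset.sum_union hd]
  refine (congrArg₂ (· + ·) ?_ rfl).trans (add_comm _ _)
  refine Finset.sum_congr rfl fun m hm => ?_
  rw [Finset.mem_Icc] at hm
  rw [← mul_assoc, mul_comm (∏ c ∈ Finset.Ico (k - 1) b, x (M + 1) c),
    ← Finset.prod_union (Finset.Ico_disjoint_Ico_consecutive _ _ _),
    Finset.Ico_union_Ico_eq_Ico hm.2 (by omega)]

theorem hCoeff_sub_one (x : ℕ → ℤ → ℂ) (M : ℕ) (s b : ℤ) :
    hCoeff x M (s - 1) (b - 1) = hCoeff (fun t c => x t (c - 1)) M s b := by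
  induction M generalizing b with
  | zero => simp [hCoeff]
  | succ M ih =>
    rw [hCoeff, hCoeff]
    refine Finset.sum_nbij' (· + 1) (· - 1) ?_ ?_ ?_ ?_ ?_
    · intro m
      simp only [Finset.mem_Icc]
      omega
    · intro m
      simp only [Finset.mem_Icc]
      omega
    · simp
    · simp
    · intro m _
      rw [← ih, add_sub_cancel_right]
      congr 1
      refine Finset.prod_nbij' (· + 1) (· - 1) ?_ ?_ ?_ ?_ ?_
      · intro m
        simp only [Finset.mem_Ico]
        omega
      · intro m
        simp only [Finset.mem_Ico]
        omega
      · simp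
      · simp
      · simp

/-! ### Strips as interlacing of row lengths, and the two determinants. -/

theorem youngDiagram_le_iff_rowLen_le {μ ν : YoungDiagram} :
    μ ≤ ν ↔ ∀ i, μ.rowLen i ≤ ν.rowLen i := by
  constructor
  · intro h i
    by_contra hlt
    have h1 : (i, ν.rowLen i) ∈ μ := YoungDiagram.mem_iff_lt_rowLen.2 (not_le.1 hlt)
    exact lt_irrefl _ (YoungDiagram.mem_iff_lt_rowLen.1 (h h1))
  · rintro h ⟨i, j⟩ hij
    exact YoungDiagram.mem_iff_lt_rowLen.2 ((YoungDiagram.mem_iff_lt_rowLen.1 hij).trans_le (h i))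

theorem mem_horizontalStrips_iff_rowLen {lam μ : YoungDiagram} :
    μ ∈ horizontalStrips lam ↔
      ∀ i, μ.rowLen i ≤ lam.rowLen i ∧ lam.rowLen (i + 1) ≤ μ.rowLen i := by
  rw [mem_horizontalStrips, youngDiagram_le_iff_rowLen_le, forall_and]
  refine and_congr_right fun _ => forall_congr' fun i => ?_
  simp only [YoungDiagram.mem_iff_lt_rowLen]
  exact ⟨fun h => not_lt.1 fun hlt => lt_irrefl _ (h _ hlt), fun h j hj => hj.trans_le h⟩

theorem transpose_mem_horizontalStrips_iff_rowLen {lam μ : YoungDiagram} :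
    μ.transpose ∈ horizontalStrips lam.transpose ↔
      ∀ i, μ.rowLen i ≤ lam.rowLen i ∧ lam.rowLen i ≤ μ.rowLen i + 1 := by
  rw [mem_horizontalStrips, YoungDiagram.transpose_le_iff, youngDiagram_le_iff_rowLen_le,
    forall_and]
  refine and_congr_right fun _ => ?_
  simp only [YoungDiagram.mem_transpose, Prod.swap_prod_mk]
  simp only [YoungDiagram.mem_iff_lt_rowLen]
  constructor
  · intro h i
    have := h (μ.rowLen i) i
    omega
  · intro h j i hj
    have := h i
    omega

theorem colLen_zero_le_iff {μ : YoungDiagram} {N : ℕ} : μ.colLen 0 ≤ N ↔ μ.rowLen N = 0 :=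
  rowLen_eq_zero_iff.symm

theorem colLen_zero_le_of_rowLen_le {lam μ : YoungDiagram} {N : ℕ} (hN : lam.colLen 0 ≤ N)
    (h : ∀ i, μ.rowLen i ≤ lam.rowLen i) : μ.colLen 0 ≤ N := by
  rw [colLen_zero_le_iff] at hN ⊢
  have := h N
  omega

/-- A Jacobi–Trudi formula for diagonally constant weights. -/
theorem tableauSum_eq_rowDet_hCoeff (x : ℕ → ℤ → ℂ) (M : ℕ) {lam : YoungDiagram} {N : ℕ}
    (hN : lam.colLen 0 ≤ N) :
    tableauSum x M lam =
      rowDet fun i s : Fin N => hCoeff x M (-(s : ℕ)) ((lam.rowLen i : ℤ) - (i : ℕ)) := by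
  induction M generalizing lam with
  | zero =>
    rw [rowDet_single_eq_tableauSum_zero x hN]
    simp only [hCoeff]
  | succ M ih =>
    -- Subtracting a multiple of the next row truncates the recursion for row `i` to `λ_{i+1} ≤ m +
    -- i ≤ λ_i`, exactly the interlacing condition for a horizontal strip.
    have hrow : (rowDet fun i s : Fin N =>
          hCoeff x (M + 1) (-(s : ℕ)) ((lam.rowLen i : ℤ) - (i : ℕ))) =
        rowDet fun i : Fin N => ∑ m ∈ Finset.Icc ((lam.rowLen (i + 1) : ℤ) - (i : ℕ))
            ((lam.rowLen i : ℤ) - (i : ℕ)),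
          (∏ c ∈ Finset.Ico m ((lam.rowLen i : ℤ) - (i : ℕ)), x (M + 1) c) •
            fun s : Fin N => hCoeff x M (-(s : ℕ)) m := by
      have hstep : ∀ (i s : Fin N),
          hCoeff x (M + 1) (-(s : ℕ)) ((lam.rowLen i : ℤ) - (i : ℕ)) =
          ∑ m ∈ Finset.Icc ((lam.rowLen (i + 1) : ℤ) - (i : ℕ))
            ((lam.rowLen i : ℤ) - (i : ℕ)),
          (∏ c ∈ Finset.Ico m ((lam.rowLen i : ℤ) - (i : ℕ)), x (M + 1) c) *
            hCoeff x M (-(s : ℕ)) m +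
          (∏ c ∈ Finset.Ico ((lam.rowLen (i + 1) : ℤ) - (i : ℕ) - 1)
            ((lam.rowLen i : ℤ) - (i : ℕ)), x (M + 1) c) *
            hCoeff x (M + 1) (-(s : ℕ)) ((lam.rowLen (i + 1) : ℤ) - (i : ℕ) - 1) := by
        intro i s
        have := lam.rowLen_anti i (i + 1) (Nat.le_succ _)
        exact hCoeff_succ_eq_add x M (by omega)
      refine rowDet_eq_of_forall_eq_add_smul_next
        (fun i => ∏ c ∈ Finset.Ico ((lam.rowLen (i + 1) : ℤ) - (i : ℕ) - 1)
            ((lam.rowLen i : ℤ) - (i : ℕ)), x (M + 1) c) ?_ ?_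
      · intro i hi
        funext s
        -- The last row has no successor, but the term to be subtracted ends at `-N`, below every
        -- column label, and vanishes.
        have hz : lam.rowLen (i + 1) = 0 := by
          rw [hi]
          exact colLen_zero_le_iff.1 hN
        rw [hstep, hCoeff_eq_zero_of_lt x (M + 1)
          (b := (lam.rowLen (i + 1) : ℤ) - (i : ℕ) - 1) (by omega), mul_zero, add_zero]
        simp [Finset.sum_apply]
      · intro i hi
        funext s
        rw [hstep]
        have : (lam.rowLen (i + 1) : ℤ) - (i : ℕ) - 1 =
            (lam.rowLen (i + 1) : ℤ) - ((i + 1 : ℕ) : ℤ) := by omega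
        rw [this]
        simp [Finset.sum_apply]
    rw [hrow, rowDet_sum_smul, tableauSum_succ]
    refine Finset.sum_bij (fun μ _ => fun i : Fin N => (μ.rowLen i : ℤ) - (i : ℕ)) ?_ ?_ ?_ ?_
    · intro μ hμ
      rw [mem_horizontalStrips_iff_rowLen] at hμ
      rw [Fintype.mem_piFinset]
      intro i
      have := hμ i
      rw [Finset.mem_Icc]
      omega
    · intro μ hμ ν hν h
      rw [mem_horizontalStrips_iff_rowLen] at hμ hν
      refine youngDiagram_ext_rowLen fun i => ?_
      by_cases hi : i < N
      · have := congrFun h ⟨i, hi⟩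
        dsimp only at this
        omega
      · have h1 := hμ i
        have h2 := hν i
        have h3 := rowLen_eq_zero_iff.2 (show lam.colLen 0 ≤ i by omega)
        omega
    · intro b hb
      rw [Fintype.mem_piFinset] at hb
      simp only [Finset.mem_Icc] at hb
      let w : ℕ → ℕ := fun r => if h : r < N then (b ⟨r, h⟩ + r).toNat else 0
      have hw : ∀ r, w r ≤ lam.rowLen r ∧ lam.rowLen (r + 1) ≤ w r := by
        intro r
        by_cases h : r < N
        · have h1 := hb ⟨r, h⟩
          have h2 : w r = (b ⟨r, h⟩ + r).toNat := dif_pos h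
          dsimp only at h1
          omega
        · have h1 := rowLen_eq_zero_iff.2 (show lam.colLen 0 ≤ r + 1 by omega)
          have h2 : w r = 0 := dif_neg h
          omega
      obtain ⟨μ, hμ⟩ := exists_youngDiagram_rowLen (w := w) (N := N)
        (antitone_nat_of_succ_le fun r => (hw (r + 1)).1.trans (hw r).2)
        (dif_neg (lt_irrefl N))
      refine ⟨μ, ?_, ?_⟩
      · rw [mem_horizontalStrips_iff_rowLen]
        simpa only [hμ] using hw
      · funext i
        have h1 := hb i
        have h2 : w i = (b i + (i : ℕ)).toNat := dif_pos i.2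
        rw [hμ, h2]
        omega
    · intro μ hμ
      rw [mem_horizontalStrips_iff_rowLen] at hμ
      rw [ih (colLen_zero_le_of_rowLen_le hN fun i => (hμ i).1), prod_content_sdiff hN]

/-- The weighted elementary symmetric functions: the sum of the weights of the rows of boxes of
contents `s, …, b - 1`, strictly decreasing with entries in `{1, …, M}`. -/
noncomputable def eCoeff (x : ℕ → ℤ → ℂ) : ℕ → ℤ → ℤ → ℂ
  | 0, s, b => if b = s then 1 else 0
  | M + 1, s, b => eCoeff x M s b + x (M + 1) (b - 1) * eCoeff x M s (b - 1)

theorem eCoeff_eq_zero_of_lt (x : ℕ → ℤ → ℂ) (M : ℕ) {s b : ℤ} (h : b < s) :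
    eCoeff x M s b = 0 := by
  induction M generalizing b with
  | zero => rw [eCoeff, if_neg h.ne]
  | succ M ih => rw [eCoeff, ih h, ih (by omega), mul_zero, add_zero]

theorem eCoeff_sub_one (x : ℕ → ℤ → ℂ) (M : ℕ) (s b : ℤ) :
    eCoeff x M (s - 1) (b - 1) = eCoeff (fun t c => x t (c - 1)) M s b := by
  induction M generalizing b with
  | zero => simp [eCoeff]
  | succ M ih => rw [eCoeff, eCoeff, ih, ih]

/-- A dual Jacobi–Trudi formula for diagonally constant weights. -/
theorem tableauSum_transpose_eq_rowDet_eCoeff (x : ℕ → ℤ → ℂ) (M : ℕ) {lam : YoungDiagram} {N : ℕ}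
    (hN : lam.colLen 0 ≤ N) :
    tableauSum (fun t c => x t (-c)) M lam.transpose =
      rowDet fun i s : Fin N => eCoeff x M (-(s : ℕ)) ((lam.rowLen i : ℤ) - (i : ℕ)) := by
  induction M generalizing lam with
  | zero =>
    have h0 : tableauSum (fun t c => x t (-c)) 0 lam.transpose = tableauSum x 0 lam := by
      rw [tableauSum_zero, tableauSum_zero, YoungDiagram.rowLen_transpose]
      congr 1
      rw [← Nat.le_zero, colLen_zero_le_iff]
    rw [h0, rowDet_single_eq_tableauSum_zero x hN]
    simp only [eCoeff]
  | succ M ih =>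
    -- Each row splits in two according to whether `M + 1` occurs in it; the exponent `m` of the
    -- weight is the number of boxes taken away, `0` or `1`.
    have hrow : (fun i s : Fin N =>
          eCoeff x (M + 1) (-(s : ℕ)) ((lam.rowLen i : ℤ) - (i : ℕ))) =
        fun i : Fin N => ∑ m ∈ Finset.range 2, x (M + 1) ((lam.rowLen i : ℤ) - (i : ℕ) - 1) ^ m •
            fun s : Fin N => eCoeff x M (-(s : ℕ)) ((lam.rowLen i : ℤ) - (i : ℕ) - (m : ℕ)) := by
      funext i s
      simp [Finset.sum_range_succ, eCoeff]
    rw [hrow, rowDet_sum_smul (fun _ => Finset.range 2)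
      (fun (i : Fin N) m => x (M + 1) ((lam.rowLen i : ℤ) - (i : ℕ) - 1) ^ m)
      (fun (i : Fin N) m (s : Fin N) => eCoeff x M (-(s : ℕ)) ((lam.rowLen i : ℤ) - (i : ℕ) - (m : ℕ))),
      tableauSum_succ]
    have hstrip : ∀ {μ : YoungDiagram}, μ ∈ horizontalStrips lam.transpose →
        ∀ i, μ.colLen i ≤ lam.rowLen i ∧ lam.rowLen i ≤ μ.colLen i + 1 := by
      intro μ hμ i
      rw [← YoungDiagram.transpose_transpose μ, transpose_mem_horizontalStrips_iff_rowLen] at hμ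
      simpa only [YoungDiagram.rowLen_transpose] using hμ i
    -- A strip corresponds to the choice of the rows losing a box. The remaining choices do not give
    -- diagrams and must be shown to contribute zero.
    refine Finset.sum_of_injOn (fun μ => fun i : Fin N => lam.rowLen i - μ.colLen i) ?_ ?_ ?_ ?_
    · intro μ hμ ν hν h
      rw [← YoungDiagram.transpose_eq_iff]
      refine youngDiagram_ext_rowLen fun i => ?_
      rw [YoungDiagram.rowLen_transpose, YoungDiagram.rowLen_transpose]
      have h1 := hstrip hμ i
      have h2 := hstrip hν i
      by_cases hi : i < N
      · have := congrFun h ⟨i, hi⟩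
        dsimp only at this
        omega
      · have h3 := rowLen_eq_zero_iff.2 (show lam.colLen 0 ≤ i by omega)
        omega
    · intro μ hμ
      rw [Finset.mem_coe, Fintype.mem_piFinset]
      intro i
      have h1 := hstrip hμ i
      rw [Finset.mem_range]
      dsimp only
      omega
    · intro ε hε hne
      rw [Fintype.mem_piFinset] at hε
      simp only [Finset.mem_range] at hε
      by_contra hdet
      refine hne ?_
      have hdet' := left_ne_zero_of_mul hdet
      -- Shortening row `i` but not the equally long row `i + 1` would produce two equal rows of the
      -- determinant.
      have hnext : ∀ (i : Fin N) (h : (i : ℕ) + 1 < N), ε i = 1 →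
          lam.rowLen i = lam.rowLen (i + 1) → ε ⟨i + 1, h⟩ = 1 := by
        intro i h h1 h2
        by_contra h3
        have h4 := hε ⟨i + 1, h⟩
        have h5 : ε ⟨i + 1, h⟩ = 0 := by omega
        refine hdet' (rowDet_eq_zero_of_eq (i := i) (j := ⟨i + 1, h⟩) ?_ ?_)
        · intro h6
          have := congrArg Fin.val h6
          dsimp only at this
          omega
        · funext s
          congr 1
          rw [h1, h5, h2]
          push_cast
          ring
      have hlast : ∀ i : Fin N, (i : ℕ) + 1 = N → lam.rowLen i = 0 → ε i = 0 := by
        intro i hi h0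
        by_contra h1
        have h2 := hε i
        have h3 : ε i = 1 := by omega
        refine hdet' (Matrix.det_eq_zero_of_row_eq_zero i fun s => ?_)
        rw [Matrix.of_apply, eCoeff_eq_zero_of_lt]
        rw [h3, h0]
        have := s.2
        push_cast
        omega
      -- Propagating upwards from the last row, no empty row is shortened; hence the truncated
      -- subtraction in `w` is a genuine one.
      have hzero : ∀ (k : ℕ) (i : Fin N), (i : ℕ) + 1 + k = N → lam.rowLen i = 0 → ε i = 0 := by
        intro k
        induction k with
        | zero => exact fun i hi => hlast i hi
        | succ k ihk =>
          intro i hi h0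
          have h1 := lam.rowLen_anti i (i + 1) (Nat.le_succ _)
          have h2 : (i : ℕ) + 1 < N := by omega
          have h3 := ihk ⟨i + 1, h2⟩ (by dsimp only; omega) (by dsimp only; omega)
          by_contra h4
          have h5 := hε i
          have h6 := hnext i h2 (by omega) (by omega)
          omega
      let w : ℕ → ℕ := fun r => if h : r < N then lam.rowLen r - ε ⟨r, h⟩ else 0
      have hw : ∀ r, w r ≤ lam.rowLen r ∧ lam.rowLen r ≤ w r + 1 ∧ w (r + 1) ≤ w r := by
        intro r
        have h1 := lam.rowLen_anti r (r + 1) (Nat.le_succ _)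
        by_cases h : r < N
        · have h2 : w r = lam.rowLen r - ε ⟨r, h⟩ := dif_pos h
          have h3 := hε ⟨r, h⟩
          by_cases h' : r + 1 < N
          · have h4 : w (r + 1) = lam.rowLen (r + 1) - ε ⟨r + 1, h'⟩ := dif_pos h'
            have h5 := hnext ⟨r, h⟩ h'
            dsimp only at h5
            omega
          · have h4 : w (r + 1) = 0 := dif_neg h'
            omega
        · have h1 := rowLen_eq_zero_iff.2 (show lam.colLen 0 ≤ r by omega)
          have h2 : w r = 0 := dif_neg h
          have h3 : w (r + 1) = 0 := dif_neg (by omega)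
          omega
      obtain ⟨μ, hμ⟩ := exists_youngDiagram_rowLen (w := w) (N := N)
        (antitone_nat_of_succ_le fun r => (hw r).2.2) (dif_neg (lt_irrefl N))
      refine ⟨μ.transpose, ?_, ?_⟩
      · rw [Finset.mem_coe, transpose_mem_horizontalStrips_iff_rowLen]
        intro i
        rw [hμ]
        exact ⟨(hw i).1, (hw i).2.1⟩
      · funext i
        have h1 : w i = lam.rowLen i - ε i := dif_pos i.2
        have h2 := hε i
        have h3 := hzero (N - 1 - i) i (by omega)
        dsimp only
        rw [YoungDiagram.colLen_transpose, hμ, h1]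
        omega
    · intro μ hμ
      have h1 := hstrip hμ
      obtain ⟨ν, rfl⟩ : ∃ ν : YoungDiagram, μ = ν.transpose :=
        ⟨μ.transpose, (YoungDiagram.transpose_transpose μ).symm⟩
      simp only [YoungDiagram.colLen_transpose] at h1 ⊢
      rw [ih (colLen_zero_le_of_rowLen_le hN fun i => (h1 i).1),
        prod_content_sdiff_transpose lam ν (x (M + 1)), prod_content_sdiff hN]
      congr 1
      · congr 1
        funext i s
        congr 1
        have := h1 i
        omega
      · refine Finset.prod_congr rfl fun i _ => ?_
        have h2 := h1 i
        obtain h3 | h3 : lam.rowLen i = ν.rowLen i ∨ lam.rowLen i = ν.rowLen i + 1 := by omega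
        · rw [h3]
          simp
        · rw [h3, Nat.add_sub_cancel_left, pow_one]
          have h4 : Finset.Ico ((ν.rowLen i : ℤ) - (i : ℕ)) (((ν.rowLen i + 1 : ℕ) : ℤ) - (i : ℕ)) =
              {((ν.rowLen i + 1 : ℕ) : ℤ) - (i : ℕ) - 1} := by
            ext c
            rw [Finset.mem_Ico, Finset.mem_singleton]
            omega
          rw [h4, Finset.prod_singleton]

/-! ### Corners -/

theorem nthSmallest_eq_getElem {s : Finset ℕ} {k : ℕ} (h1 : 1 ≤ k) (h2 : k ≤ s.card) :
    nthSmallest s k = (s.sort (· ≤ ·))[k - 1]'(by rw [Finset.length_sort]; omega) := by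
  rw [nthSmallest, List.getD_eq_getElem]

theorem nthSmallest_mem {s : Finset ℕ} {k : ℕ} (h1 : 1 ≤ k) (h2 : k ≤ s.card) :
    nthSmallest s k ∈ s := by
  rw [nthSmallest_eq_getElem h1 h2, ← Finset.mem_sort (· ≤ ·)]
  exact List.getElem_mem _

theorem nthSmallest_lt {s : Finset ℕ} {j k : ℕ} (h1 : 1 ≤ j) (h2 : j < k) (h3 : k ≤ s.card) :
    nthSmallest s j < nthSmallest s k := by
  rw [nthSmallest_eq_getElem h1 (by omega), nthSmallest_eq_getElem (by omega) h3]
  exact (Finset.sortedLT_sort s).getElem_lt_getElem_of_lt (by omega)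

theorem exists_nthSmallest_eq {s : Finset ℕ} {a : ℕ} (ha : a ∈ s) :
    ∃ k, 1 ≤ k ∧ k ≤ s.card ∧ nthSmallest s k = a := by
  rw [← Finset.mem_sort (· ≤ ·)] at ha
  obtain ⟨i, hi, rfl⟩ := List.getElem_of_mem ha
  have hi' := hi
  rw [Finset.length_sort] at hi'
  exact ⟨i + 1, by omega, by omega, nthSmallest_eq_getElem (by omega) (by omega)⟩

section Corners

variable (lam : YoungDiagram)

theorem mem_corners {i j : ℕ} :
    (i, j) ∈ corners lam ↔ j + 1 = lam.rowLen i ∧ lam.rowLen (i + 1) < lam.rowLen i := by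
  simp only [corners, Finset.mem_filter, YoungDiagram.mem_cells, YoungDiagram.mem_iff_lt_rowLen]
  have := lam.rowLen_anti i (i + 1) (Nat.le_succ _)
  omega

theorem mem_image_corners {a : ℕ} :
    a ∈ (corners lam).image (fun x => x.1 + 1) ↔ 1 ≤ a ∧ lam.rowLen a < lam.rowLen (a - 1) := by
  rw [Finset.mem_image]
  constructor
  · rintro ⟨⟨i, j⟩, h, rfl⟩
    rw [mem_corners] at h
    simpa using h.2
  · rintro ⟨h1, h2⟩
    refine ⟨(a - 1, lam.rowLen (a - 1) - 1), ?_, by dsimp only; omega⟩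
    rw [mem_corners, Nat.sub_add_cancel h1]
    omega

theorem card_image_corners :
    ((corners lam).image fun x => x.1 + 1).card = (corners lam).card := by
  refine Finset.card_image_of_injOn ?_
  rintro ⟨i, j⟩ h ⟨i', j'⟩ h' heq
  rw [Finset.mem_coe, mem_corners] at h h'
  obtain rfl : i = i' := by simpa using heq
  obtain rfl : j = j' := by omega
  rfl

/-- A column height is a row after which the row length drops; hence the `d`-th smallest height is
the row of the `d`-th corner. -/
theorem colHeights_eq_image_corners :
    colHeights lam = (corners lam).image fun x => x.1 + 1 := by
  ext a
  rw [mem_image_corners, colHeights, Finset.mem_image]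
  have hcol : ∀ i j, i < lam.colLen j ↔ j < lam.rowLen i := fun i j => by
    rw [← YoungDiagram.mem_iff_lt_colLen, YoungDiagram.mem_iff_lt_rowLen]
  constructor
  · rintro ⟨j, hj, rfl⟩
    rw [Finset.mem_range, ← hcol] at hj
    have h1 := hcol (lam.colLen j) j
    have h2 := hcol (lam.colLen j - 1) j
    omega
  · rintro ⟨h1, h2⟩
    refine ⟨lam.rowLen a, ?_, ?_⟩
    · have := lam.rowLen_anti 0 (a - 1) (Nat.zero_le _)
      rw [Finset.mem_range]
      omega
    · have h3 := hcol a (lam.rowLen a)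
      have h4 := hcol (a - 1) (lam.rowLen a)
      omega

variable {lam}

theorem cornerRow_spec {p : ℕ} (h1 : 1 ≤ p) (h2 : p ≤ (corners lam).card) :
    1 ≤ cornerRow lam p ∧
      lam.rowLen (cornerRow lam p) < lam.rowLen (cornerRow lam p - 1) := by
  rw [← card_image_corners] at h2
  exact (mem_image_corners lam).1 (nthSmallest_mem h1 h2)

theorem cornerRow_le_colLen {p : ℕ} (h1 : 1 ≤ p) (h2 : p ≤ (corners lam).card) :
    cornerRow lam p ≤ lam.colLen 0 := by
  have h3 := cornerRow_spec h1 h2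
  have h4 := (rowLen_eq_zero_iff (μ := lam) (i := cornerRow lam p - 1)).2
  omega

theorem cornerRow_lt {p q : ℕ} (h1 : 1 ≤ p) (h : p < q) (h2 : q ≤ (corners lam).card) :
    cornerRow lam p < cornerRow lam q := by
  rw [← card_image_corners] at h2
  exact nthSmallest_lt h1 h h2

theorem cornerRow_le {p q : ℕ} (h1 : 1 ≤ p) (h : p ≤ q) (h2 : q ≤ (corners lam).card) :
    cornerRow lam p ≤ cornerRow lam q := by
  rcases h.eq_or_lt with rfl | h
  · exact le_rfl
  · exact (cornerRow_lt h1 h h2).le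

theorem exists_cornerRow_eq {i : ℕ} (h : lam.rowLen (i + 1) < lam.rowLen i) :
    ∃ p, 1 ≤ p ∧ p ≤ (corners lam).card ∧ cornerRow lam p = i + 1 := by
  rw [← card_image_corners]
  exact exists_nthSmallest_eq ((mem_image_corners lam).2 ⟨by omega, by simpa using h⟩)

theorem rowLen_eq_of_forall_cornerRow_ne {i j : ℕ} (hij : i ≤ j)
    (h : ∀ p, 1 ≤ p → p ≤ (corners lam).card → ¬ (i < cornerRow lam p ∧ cornerRow lam p ≤ j)) :
    lam.rowLen j = lam.rowLen i := by
  induction j, hij using Nat.le_induction with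
  | base => rfl
  | succ j hij ih =>
    rw [← ih fun p h1 h2 h3 => h p h1 h2 ⟨h3.1, by omega⟩]
    refine le_antisymm (lam.rowLen_anti _ _ (Nat.le_succ _)) (not_lt.1 fun hlt => ?_)
    obtain ⟨p, h1, h2, h3⟩ := exists_cornerRow_eq hlt
    exact h p h1 h2 (by omega)

theorem cornerCol_eq {p : ℕ} (h1 : 1 ≤ p) (h2 : p ≤ (corners lam).card) :
    cornerCol lam p = lam.rowLen (cornerRow lam p - 1) := by
  rw [cornerCol, if_pos ⟨h1, h2⟩]

/-- Row lengths are constant between consecutive corner rows, and zero after the last one, which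
matches the convention `m_{n+1} = 0`. -/
theorem cornerCol_succ_eq {p : ℕ} (h1 : 1 ≤ p) (h2 : p ≤ (corners lam).card) :
    cornerCol lam (p + 1) = lam.rowLen (cornerRow lam p) := by
  by_cases h3 : p + 1 ≤ (corners lam).card
  · have h4 : cornerRow lam p < cornerRow lam (p + 1) := cornerRow_lt h1 (Nat.lt_succ_self p) h3
    rw [cornerCol_eq (by omega) h3]
    refine rowLen_eq_of_forall_cornerRow_ne (by omega) fun q hq1 hq2 hq => ?_
    rcases Nat.lt_or_ge p q with h5 | h5
    · have : cornerRow lam (p + 1) ≤ cornerRow lam q := cornerRow_le (by omega) h5 hq2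
      omega
    · have := cornerRow_le hq1 h5 h2
      omega
  · have h4 := cornerRow_le_colLen h1 h2
    have h5 : lam.rowLen (lam.colLen 0) = 0 := rowLen_eq_zero_iff.2 le_rfl
    rw [cornerCol, if_neg (by omega), ← h5]
    refine rowLen_eq_of_forall_cornerRow_ne h4 fun q hq1 hq2 hq => ?_
    have := cornerRow_le hq1 (show q ≤ p by omega) h2
    omega

end Corners

/-! ### Rows of determinants under the addition and the removal of strips -/

section Cycle

variable {N : ℕ} {α : Type*}

theorem cycleIcc_val {i j : Fin N} (hij : i ≤ j) (r : Fin N) :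
    (Fin.cycleIcc i j r : ℕ) =
      if r = j then (i : ℕ) else if i ≤ r ∧ r < j then (r : ℕ) + 1 else r := by
  have : NeZero N := ⟨by have := i.2; omega⟩
  split_ifs with h1 h2
  · rw [h1, Fin.cycleIcc_of_last hij]
  · rw [Fin.cycleIcc_of_ge_of_lt h2.1 h2.2, Fin.val_add_one_of_lt']
    have := h2.2
    have := j.2
    omega
  · rcases lt_or_ge r i with h3 | h3
    · rw [Fin.cycleIcc_of_lt h3]
    · rw [Fin.cycleIcc_of_gt]
      rcases lt_or_ge r j with h4 | h4
      · exact absurd ⟨h3, h4⟩ h2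
      · exact lt_of_le_of_ne h4 (Ne.symm h1)

/-- Dropping entry `i`, moving the entries up to `j` one place towards `i` and inserting `x` at `j`
is an update at `i` followed by a cycle. This is the effect of removing a strip;
`eq_update_comp_cycleIcc_inv` is the version for adding one. -/
theorem eq_update_comp_cycleIcc {i j : Fin N} (hij : i ≤ j) {u u' : Fin N → α} {x : α}
    (hj : u' j = x)
    (hmid : ∀ r r' : Fin N, i ≤ r → r < j → (r' : ℕ) = r + 1 → u' r = u r')
    (hout : ∀ r, r < i ∨ j < r → u' r = u r) :
    u' = fun r => Function.update u i x (Fin.cycleIcc i j r) := by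
  funext r
  have hv := cycleIcc_val hij r
  by_cases h1 : r = j
  · subst h1
    rw [if_pos rfl] at hv
    rw [Fin.ext hv, Function.update_self, hj]
  · rw [if_neg h1] at hv
    by_cases h2 : i ≤ r ∧ r < j
    · rw [if_pos h2] at hv
      rw [Function.update_of_ne, hmid r _ h2.1 h2.2 hv]
      intro h3
      rw [h3] at hv
      have := h2.1
      omega
    · rw [if_neg h2] at hv
      have h3 : r < i ∨ j < r := by
        by_contra h3
        omega
      rw [Fin.ext hv, Function.update_of_ne (by rintro rfl; omega), hout r h3]

theorem eq_update_comp_cycleIcc_inv {i j : Fin N} (hij : i ≤ j) {u u' : Fin N → α} {x : α}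
    (hi : u' i = x)
    (hmid : ∀ r r' : Fin N, i < r → r ≤ j → (r' : ℕ) + 1 = r → u' r = u r')
    (hout : ∀ r, r < i ∨ j < r → u' r = u r) :
    u' = fun r => Function.update u j x ((Fin.cycleIcc i j)⁻¹ r) := by
  have key : ∀ r, u' (Fin.cycleIcc i j r) = Function.update u j x r := by
    intro r
    have hv := cycleIcc_val hij r
    by_cases h1 : r = j
    · subst h1
      rw [if_pos rfl] at hv
      rw [Fin.ext hv, Function.update_self, hi]
    · rw [if_neg h1] at hv
      rw [Function.update_of_ne h1]
      by_cases h2 : i ≤ r ∧ r < j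
      · rw [if_pos h2] at hv
        exact hmid _ _ (by rw [Fin.lt_def]; omega) (by rw [Fin.le_def]; omega) hv.symm
      · rw [if_neg h2] at hv
        rw [Fin.ext hv]
        exact hout r (by by_contra h3; omega)
  funext r
  rw [← key]
  simp

theorem update_comp_perm_of_fixed {σ : Equiv.Perm (Fin N)} {j : Fin N} (hσ : σ j = j)
    (u : Fin N → α) (x : α) :
    (Function.update (fun i => u (σ i)) j x) = fun i => Function.update u j x (σ i) := by
  funext i
  by_cases h : i = j
  · subst h
    rw [hσ, Function.update_self, Function.update_self]
  · rw [Function.update_of_ne h, Function.update_of_ne]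
    rw [← hσ]
    exact fun h' => h (σ.injective h')

end Cycle

theorem addCorners_succ (lam : YoungDiagram) {t : ℕ} (p q : Fin (t + 1) → ℕ) :
    addCorners lam p q =
      (addCorners lam (fun k => p k.succ) fun k => q k.succ).bind (addCorner lam (p 0) (q 0)) := by
  simp only [addCorners, List.ofFn_succ, List.foldr_cons]

theorem remCorners_succ (lam : YoungDiagram) {t : ℕ} (p q : Fin (t + 1) → ℕ) :
    remCorners lam p q =
      (remCorners lam (fun k => p k.succ) fun k => q k.succ).bind (remCorner lam (p 0) (q 0)) := by
  simp only [remCorners, List.ofFn_succ, List.foldr_cons]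

section Strips

variable {lam : YoungDiagram} {N : ℕ} {α : Type*} {B T : ℕ → Fin N}

/-- Strips are added from the innermost outwards. An outer strip starts above and ends below all
inner ones, where the shape is still `λ`, so it inserts the row `g (B p)` at its top and loses the
row `T q` of `f`, with a cycle of sign `(-1)^(r_q - r_p)`. The statements on unchanged rows, on
growth and on fixed points of `σ` keep the induction going. -/
theorem addCorners_eq_some
    (hB : ∀ p, 1 ≤ p → p ≤ (corners lam).card → (B p : ℕ) = cornerRow lam p - 1)
    (hT : ∀ q, 1 ≤ q → q ≤ (corners lam).card → (T q : ℕ) = cornerRow lam q)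
    (h : ℤ → α) {g : Fin N → α}
    (hg : ∀ i : Fin N, (i : ℕ) < lam.colLen 0 →
      g i = h ((lam.rowLen i : ℤ) - (i : ℕ) - 1))
    {t : ℕ} {p q : Fin t → ℕ} (hp : ∀ k, 1 ≤ p k) (hq : ∀ k, q k ≤ (corners lam).card)
    (hpq : ∀ k l, p k ≤ q l) (hpm : StrictMono p) (hqm : StrictAnti q) :
    ∃ ν, addCorners lam p q = some ν ∧
      (∀ r, (∀ k, r < cornerRow lam (p k)) → ν.rowLen r = lam.rowLen r) ∧
      (∀ r, (∀ k, cornerRow lam (q k) < r) → ν.rowLen r = lam.rowLen r) ∧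
      (∀ r, lam.rowLen r ≤ ν.rowLen r) ∧
      ∃ σ : Equiv.Perm (Fin N),
        Equiv.Perm.sign σ = (-1) ^ (∑ k, (cornerRow lam (q k) - cornerRow lam (p k))) ∧
        ((fun i : Fin N => h ((ν.rowLen i : ℤ) - (i : ℕ))) = fun i =>
          Function.extend (fun k => T (q k)) (fun k => g (B (p k)))
            (fun i : Fin N => h ((lam.rowLen i : ℤ) - (i : ℕ))) (σ i)) ∧
        ∀ i : Fin N, (∀ k, cornerRow lam (q k) < i) → σ i = i := by
  induction t with
  | zero =>
    refine ⟨lam, rfl, fun _ _ => rfl, fun _ _ => rfl, fun _ => le_rfl, 1, by simp, ?_, by simp⟩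
    funext i
    rw [Function.extend_apply' _ _ _ (by simp)]
    rfl
  | succ t ih =>
    obtain ⟨ν, hν, hlow, hhigh, hge, σ, hsign, hrows, hfix⟩ :=
      ih (p := fun k => p k.succ) (q := fun k => q k.succ) (fun k => hp _) (fun k => hq _)
        (fun k l => hpq _ _) (fun a b hab => hpm (Fin.succ_lt_succ_iff.2 hab))
        (fun a b hab => hqm (Fin.succ_lt_succ_iff.2 hab))
    have hq1 : ∀ k, 1 ≤ q k := fun k => (hp k).trans (hpq k k)
    have hpn : ∀ k, p k ≤ (corners lam).card := fun k => (hpq k k).trans (hq k)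
    have hp0 : ∀ k : Fin t, cornerRow lam (p 0) < cornerRow lam (p k.succ) := fun k =>
      cornerRow_lt (hp 0) (hpm (Fin.succ_pos k)) (hpn _)
    have hq0 : ∀ k : Fin t, cornerRow lam (q k.succ) < cornerRow lam (q 0) := fun k =>
      cornerRow_lt (hq1 _) (hqm (Fin.succ_pos k)) (hq _)
    have hpq0 : cornerRow lam (p 0) ≤ cornerRow lam (q 0) := cornerRow_le (hp 0) (hpq 0 0) (hq 0)
    have hps := cornerRow_spec (hp 0) (hpn 0)
    have hqs := cornerRow_spec (hq1 0) (hq 0)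
    have hqN := cornerRow_le_colLen (hq1 0) (hq 0)
    have hTq := hT _ (hq1 0) (hq 0)
    have hBp := hB _ (hp 0) (hpn 0)
    have hν1 : ν.rowLen (cornerRow lam (p 0)) = lam.rowLen (cornerRow lam (p 0)) :=
      hlow _ hp0
    have hν2 : ν.rowLen (cornerRow lam (p 0) - 1) = lam.rowLen (cornerRow lam (p 0) - 1) :=
      hlow _ fun k => (Nat.sub_le _ _).trans_lt (hp0 k)
    have hν3 : ν.rowLen (cornerRow lam (q 0)) = lam.rowLen (cornerRow lam (q 0)) :=
      hhigh _ hq0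
    have hν4 := hge (cornerRow lam (q 0) - 1)
    obtain ⟨μ, hμ, hμrow⟩ := addStrip_eq_some (ν := ν) (i := cornerRow lam (p 0))
      (j := cornerRow lam (q 0)) (c := cornerCol lam (p 0) - 1) hps.1 hpq0
      (by rw [cornerCol_eq (hp 0) (hpn 0)]; omega)
      (by rw [cornerCol_eq (hp 0) (hpn 0)]; omega) (by omega)
    rw [cornerCol_eq (hp 0) (hpn 0)] at hμ hμrow
    have hμ' : addCorner lam (p 0) (q 0) ν = some μ := by
      rw [addCorner, cellAt, cellAt, cornerCol_succ_eq (hq1 0) (hq 0),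
        cornerCol_eq (hp 0) (hpn 0), ← hν3]
      simpa using hμ
    refine ⟨μ, by rw [addCorners_succ, hν]; exact hμ', ?_, ?_, ?_, ?_⟩
    · intro r hr
      have h0 := hr 0
      rw [hμrow, if_neg (by omega), if_neg (by omega)]
      exact hlow r fun k => hr k.succ
    · intro r hr
      have h0 := hr 0
      rw [hμrow, if_neg (by omega), if_neg (by omega)]
      exact hhigh r fun k => hr k.succ
    · intro r
      have h1 := hge r
      rw [hμrow]
      split_ifs with h2 h3
      · subst h2
        omega
      · have := hge (r - 1)
        have := lam.rowLen_anti (r - 1) r (by omega)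
        omega
      · exact h1
    · let i₀ : Fin N := ⟨cornerRow lam (p 0), by have := (T (q 0)).2; omega⟩
      let j₀ : Fin N := T (q 0)
      have hij : i₀ ≤ j₀ := by
        rw [Fin.le_def]
        dsimp only [i₀, j₀]
        omega
      -- The earlier permutations have not reached row `T (q 0)`, so updating that row commutes with
      -- them.
      have hσj : σ j₀ = j₀ := hfix j₀ fun k => by
        dsimp only [j₀]
        rw [hTq]
        exact hq0 k
      have hup := eq_update_comp_cycleIcc_inv hij (u := fun i : Fin N =>
        h ((ν.rowLen i : ℤ) - (i : ℕ))) (u' := fun i : Fin N => h ((μ.rowLen i : ℤ) - (i : ℕ)))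
        (x := g (B (p 0))) ?_ ?_ ?_
      · refine ⟨σ * (Fin.cycleIcc i₀ j₀)⁻¹, ?_, ?_, ?_⟩
        · rw [Equiv.Perm.sign_mul, Equiv.Perm.sign_inv, Fin.sign_cycleIcc_of_le hij, hsign,
            Fin.sum_univ_succ, ← pow_add, add_comm]
          dsimp only [i₀, j₀]
          rw [hTq]
        · rw [hup, hrows, update_comp_perm_of_fixed hσj, extend_succ_eq_update]
          · rfl
          · intro a b hab
            have h1 := congrArg Fin.val hab
            dsimp only at h1
            rw [hT _ (hq1 a) (hq a), hT _ (hq1 b) (hq b)] at h1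
            rcases lt_trichotomy a b with h2 | h2 | h2
            · have := cornerRow_lt (hq1 b) (hqm h2) (hq a)
              omega
            · exact h2
            · have := cornerRow_lt (hq1 a) (hqm h2) (hq b)
              omega
        · intro i hi
          have h1 : (Fin.cycleIcc i₀ j₀)⁻¹ i = i := by
            rw [Equiv.Perm.inv_eq_iff_eq, Fin.cycleIcc_of_gt]
            rw [Fin.lt_def]
            dsimp only [j₀]
            rw [hTq]
            exact hi 0
          rw [Equiv.Perm.mul_apply, h1]
          exact hfix i fun k => hi k.succ
      · have h1 := hg (B (p 0)) (by rw [hBp]; omega)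
        rw [h1, hBp]
        dsimp only [i₀]
        rw [hμrow, if_pos rfl]
        congr 1
        omega
      · intro r r' h1 h2 h3
        rw [Fin.lt_def] at h1
        rw [Fin.le_def] at h2
        dsimp only [i₀, j₀] at h1 h2 ⊢
        rw [hμrow, if_neg (by omega), if_pos (by omega)]
        congr 1
        rw [← h3, Nat.add_sub_cancel]
        omega
      · intro r hr
        rw [Fin.lt_def, Fin.lt_def] at hr
        dsimp only [i₀, j₀] at hr ⊢
        rw [hμrow, if_neg (by omega), if_neg (by omega)]

/-- The mirror image of `addCorners_eq_some`: each strip drops the row `B p` of `g` and inserts the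
row `T q` of `f` at its bottom. The sign exponent is the same, so the two signs cancel in a product.
The row `e` below the diagram is never touched. -/
theorem remCorners_eq_some
    (hB : ∀ p, 1 ≤ p → p ≤ (corners lam).card → (B p : ℕ) = cornerRow lam p - 1)
    (hT : ∀ q, 1 ≤ q → q ≤ (corners lam).card → (T q : ℕ) = cornerRow lam q)
    (h : ℤ → α) (e : α)
    {t : ℕ} {p q : Fin t → ℕ} (hp : ∀ k, 1 ≤ p k) (hq : ∀ k, q k ≤ (corners lam).card)
    (hpq : ∀ k l, p k ≤ q l) (hpm : StrictMono p) (hqm : StrictAnti q) :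
    ∃ ν, remCorners lam p q = some ν ∧
      (∀ r, (∀ k, r + 1 < cornerRow lam (p k)) → ν.rowLen r = lam.rowLen r) ∧
      (∀ r, (∀ k, cornerRow lam (q k) ≤ r) → ν.rowLen r = lam.rowLen r) ∧
      ∃ σ : Equiv.Perm (Fin N),
        Equiv.Perm.sign σ = (-1) ^ (∑ k, (cornerRow lam (q k) - cornerRow lam (p k))) ∧
        ((fun i : Fin N =>
            if (i : ℕ) < lam.colLen 0 then h ((ν.rowLen i : ℤ) - (i : ℕ) - 1) else e) = fun i =>
          Function.extend (fun k => B (p k))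
            (fun k => h ((lam.rowLen (T (q k)) : ℤ) - (T (q k) : ℕ)))
            (fun i : Fin N =>
              if (i : ℕ) < lam.colLen 0 then h ((lam.rowLen i : ℤ) - (i : ℕ) - 1) else e)
            (σ i)) ∧
        ∀ i : Fin N, (∀ k, (i : ℕ) + 1 < cornerRow lam (p k)) → σ i = i := by
  induction t with
  | zero =>
    refine ⟨lam, rfl, fun _ _ => rfl, fun _ _ => rfl, 1, by simp, ?_, by simp⟩
    funext i
    rw [Function.extend_apply' _ _ _ (by simp)]
    rfl
  | succ t ih =>
    obtain ⟨ν, hν, hlow, hhigh, σ, hsign, hrows, hfix⟩ :=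
      ih (p := fun k => p k.succ) (q := fun k => q k.succ) (fun k => hp _) (fun k => hq _)
        (fun k l => hpq _ _) (fun a b hab => hpm (Fin.succ_lt_succ_iff.2 hab))
        (fun a b hab => hqm (Fin.succ_lt_succ_iff.2 hab))
    have hq1 : ∀ k, 1 ≤ q k := fun k => (hp k).trans (hpq k k)
    have hpn : ∀ k, p k ≤ (corners lam).card := fun k => (hpq k k).trans (hq k)
    have hp0 : ∀ k : Fin t, cornerRow lam (p 0) < cornerRow lam (p k.succ) := fun k =>
      cornerRow_lt (hp 0) (hpm (Fin.succ_pos k)) (hpn _)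
    have hq0 : ∀ k : Fin t, cornerRow lam (q k.succ) < cornerRow lam (q 0) := fun k =>
      cornerRow_lt (hq1 _) (hqm (Fin.succ_pos k)) (hq _)
    have hpq0 : cornerRow lam (p 0) ≤ cornerRow lam (q 0) := cornerRow_le (hp 0) (hpq 0 0) (hq 0)
    have hps := cornerRow_spec (hp 0) (hpn 0)
    have hqs := cornerRow_spec (hq1 0) (hq 0)
    have hqN := cornerRow_le_colLen (hq1 0) (hq 0)
    have hTq := hT _ (hq1 0) (hq 0)
    have hBp := hB _ (hp 0) (hpn 0)
    have hν1 : ν.rowLen (cornerRow lam (p 0) - 1) = lam.rowLen (cornerRow lam (p 0) - 1) :=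
      hlow _ fun k => by
        have := hp0 k
        omega
    have hν2 : ν.rowLen (cornerRow lam (q 0)) = lam.rowLen (cornerRow lam (q 0)) :=
      hhigh _ fun k => (hq0 k).le
    have hν3 : ν.rowLen (cornerRow lam (q 0) - 1) = lam.rowLen (cornerRow lam (q 0) - 1) :=
      hhigh _ fun k => by
        have := hq0 k
        omega
    obtain ⟨μ, hμ, hμrow⟩ := remStrip_eq_some (ν := ν) (i := cornerRow lam (p 0) - 1)
      (j := cornerRow lam (q 0) - 1) (c := lam.rowLen (cornerRow lam (q 0))) (by omega)
      (by rw [Nat.sub_add_cancel hqs.1, hν2]) (by omega)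
    have hμ' : remCorner lam (p 0) (q 0) ν = some μ := by
      rw [remCorner, cellAt, cellAt, cornerCol_succ_eq (hq1 0) (hq 0),
        cornerCol_eq (hp 0) (hpn 0), ← hν1]
      simpa using hμ
    refine ⟨μ, by rw [remCorners_succ, hν]; exact hμ', ?_, ?_, ?_⟩
    · intro r hr
      have h0 := hr 0
      rw [hμrow, if_neg (by omega), if_neg (by omega)]
      exact hlow r fun k => hr k.succ
    · intro r hr
      have h0 := hr 0
      rw [hμrow, if_neg (by omega), if_neg (by omega)]
      exact hhigh r fun k => hr k.succ
    · let i₀ : Fin N := B (p 0)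
      let j₀ : Fin N := ⟨cornerRow lam (q 0) - 1, by have := (T (q 0)).2; omega⟩
      have hij : i₀ ≤ j₀ := by
        rw [Fin.le_def]
        dsimp only [i₀, j₀]
        omega
      have hσi : σ i₀ = i₀ := hfix i₀ fun k => by
        have := hp0 k
        dsimp only [i₀]
        rw [hBp]
        omega
      have hup := eq_update_comp_cycleIcc hij (u := fun i : Fin N =>
        if (i : ℕ) < lam.colLen 0 then h ((ν.rowLen i : ℤ) - (i : ℕ) - 1) else e)
        (u' := fun i : Fin N =>
          if (i : ℕ) < lam.colLen 0 then h ((μ.rowLen i : ℤ) - (i : ℕ) - 1) else e)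
        (x := h ((lam.rowLen (T (q 0)) : ℤ) - (T (q 0) : ℕ))) ?_ ?_ ?_
      · refine ⟨σ * Fin.cycleIcc i₀ j₀, ?_, ?_, ?_⟩
        · rw [Equiv.Perm.sign_mul, Fin.sign_cycleIcc_of_le hij, hsign,
            Fin.sum_univ_succ, ← pow_add, add_comm]
          dsimp only [i₀, j₀]
          rw [hBp]
          congr 2
          omega
        · rw [hup, hrows, update_comp_perm_of_fixed hσi, extend_succ_eq_update]
          · rfl
          · intro a b hab
            have h1 := congrArg Fin.val hab
            dsimp only at h1
            rw [hB _ (hp a) (hpn a), hB _ (hp b) (hpn b)] at h1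
            have h3 := (cornerRow_spec (hp a) (hpn a)).1
            have h4 := (cornerRow_spec (hp b) (hpn b)).1
            rcases lt_trichotomy a b with h2 | h2 | h2
            · have := cornerRow_lt (hp a) (hpm h2) (hpn b)
              omega
            · exact h2
            · have := cornerRow_lt (hp b) (hpm h2) (hpn a)
              omega
        · intro i hi
          have h1 : Fin.cycleIcc i₀ j₀ i = i := by
            rw [Fin.cycleIcc_of_lt]
            have := hi 0
            rw [Fin.lt_def]
            dsimp only [i₀]
            rw [hBp]
            omega
          rw [Equiv.Perm.mul_apply, h1]
          exact hfix i fun k => hi k.succ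
      · dsimp only [j₀]
        rw [hμrow, if_pos rfl, if_pos (by omega), hTq]
        congr 1
        omega
      · intro r r' h1 h2 h3
        rw [Fin.lt_def] at h2
        rw [Fin.le_def] at h1
        dsimp only [i₀, j₀] at h1 h2 ⊢
        -- This makes `ν_{r+1}` positive, so that subtracting `1` from it is not truncated.
        have h4 := ν.rowLen_anti (r + 1) (cornerRow lam (q 0) - 1) (by omega)
        rw [if_pos (by omega), if_pos (by omega), hμrow, if_neg (by omega), if_pos (by omega), h3]
        congr 1
        omega
      · intro r hr
        rw [Fin.lt_def, Fin.lt_def] at hr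
        dsimp only [i₀, j₀] at hr ⊢
        have h1 : μ.rowLen r = ν.rowLen r := by
          rw [hμrow, if_neg (by omega), if_neg (by omega)]
        rw [h1]

end Strips

/-! ### The identities -/

/-- Expansion along the last row; the entry `(-1) ^ k` cancels the cofactor sign. Deleting column
`0` raises the column index by one, which matches the shift of contents in the second factor. -/
theorem rowDet_snoc_single {R : Type*} [CommRing R] {k : ℕ} (u : Fin (k + 1) → Fin (k + 1) → R) :
    rowDet (fun i : Fin (k + 1) =>
        if (i : ℕ) < k then u i else fun s => if s = 0 then (-1) ^ k else 0) =
      rowDet fun i s : Fin k => u i.castSucc s.succ := by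
  rw [rowDet, Matrix.det_succ_row _ (Fin.last k), Finset.sum_eq_single 0]
  · have h1 : ((-1 : R)) ^ k * (-1) ^ k = 1 := by
      rw [← mul_pow, neg_one_mul, neg_neg, one_pow]
    simp only [Matrix.of_apply, Fin.val_last, Fin.val_zero, add_zero, lt_self_iff_false, if_false,
      if_true, h1, one_mul, rowDet]
    congr 1
    ext i s
    simp [Matrix.submatrix_apply]
  · intro s _ hs
    simp [hs]
  · simp

theorem exchange_identity {lam : YoungDiagram} {n d : ℕ} (hn : (corners lam).card = n)
    (hd : 1 ≤ d) (hdn : d ≤ n) {H : ℤ → ℤ → ℂ} {Z₁ Z₂ : YoungDiagram → ℂ}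
    (hZ₁ : ∀ ν : YoungDiagram, ν.colLen 0 ≤ lam.colLen 0 + 1 →
      Z₁ ν = rowDet fun i s : Fin (lam.colLen 0 + 1) =>
        H (-(s : ℕ)) ((ν.rowLen i : ℤ) - (i : ℕ)))
    (hZ₂ : ∀ ν : YoungDiagram, ν.colLen 0 ≤ lam.colLen 0 →
      Z₂ ν = rowDet fun i s : Fin (lam.colLen 0) =>
        H (-(s : ℕ) - 1) ((ν.rowLen i : ℤ) - (i : ℕ) - 1))
    {l : ℕ} (hl : l = nthSmallest (colHeights lam) d) :
    ((subOnes lam l).isSome ∧ (addOnes lam l).isSome ∧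
      ∀ t ∈ Finset.Icc 1 (min d (n - d + 1)), ∀ x ∈ nestedPairs n d t,
        (addCorners lam x.1 x.2).isSome ∧ (remCorners lam x.1 x.2).isSome) ∧
    Z₁ lam * Z₂ lam = (subOnes lam l).elim 0 Z₁ * (addOnes lam l).elim 0 Z₂ +
      ∑ t ∈ Finset.Icc 1 (min d (n - d + 1)), (-1 : ℂ) ^ (t - 1) *
        ∑ x ∈ nestedPairs n d t,
          (addCorners lam x.1 x.2).elim 0 Z₁ * (remCorners lam x.1 x.2).elim 0 Z₂ := by
  subst hn
  have hl' : l = cornerRow lam d := by rw [hl, colHeights_eq_image_corners, cornerRow]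
  clear hl
  subst hl'
  have hlspec := cornerRow_spec hd hdn
  have hlk := cornerRow_le_colLen hd hdn
  have hZ₂' : ∀ ν : YoungDiagram, ν.colLen 0 ≤ lam.colLen 0 →
      Z₂ ν = rowDet fun i : Fin (lam.colLen 0 + 1) => if (i : ℕ) < lam.colLen 0 then
        (fun s : Fin (lam.colLen 0 + 1) => H (-(s : ℕ)) ((ν.rowLen i : ℤ) - (i : ℕ) - 1))
        else fun s => if s = 0 then (-1) ^ lam.colLen 0 else 0 := by
    intro ν hν
    rw [rowDet_snoc_single fun (i s : Fin (lam.colLen 0 + 1)) =>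
      H (-(s : ℕ)) ((ν.rowLen i : ℤ) - (i : ℕ) - 1), hZ₂ ν hν]
    congr 1
    funext i s
    rw [Fin.val_succ, Fin.val_castSucc]
    congr 1
    push_cast
    ring
  let h : ℤ → Fin (lam.colLen 0 + 1) → ℂ := fun b s => H (-(s : ℕ)) b
  let e : Fin (lam.colLen 0 + 1) → ℂ := fun s => if s = 0 then (-1) ^ lam.colLen 0 else 0
  let f : Fin (lam.colLen 0 + 1) → Fin (lam.colLen 0 + 1) → ℂ := fun i =>
    h ((lam.rowLen i : ℤ) - (i : ℕ))
  let g : Fin (lam.colLen 0 + 1) → Fin (lam.colLen 0 + 1) → ℂ := fun i =>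
    if (i : ℕ) < lam.colLen 0 then h ((lam.rowLen i : ℤ) - (i : ℕ) - 1) else e
  -- `B p` is the row of corner `p` and `T q` the row just below corner `q`, both counted from `0`;
  -- the reduction modulo the size has no effect at actual corners.
  let B : ℕ → Fin (lam.colLen 0 + 1) := fun p => Fin.ofNat _ (cornerRow lam p - 1)
  let T : ℕ → Fin (lam.colLen 0 + 1) := fun q => Fin.ofNat _ (cornerRow lam q)
  have hB : ∀ p, 1 ≤ p → p ≤ (corners lam).card → (B p : ℕ) = cornerRow lam p - 1 := by
    intro p h1 h2
    have := cornerRow_le_colLen h1 h2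
    exact Nat.mod_eq_of_lt (by omega)
  have hT : ∀ q, 1 ≤ q → q ≤ (corners lam).card → (T q : ℕ) = cornerRow lam q := by
    intro p h1 h2
    have := cornerRow_le_colLen h1 h2
    exact Nat.mod_eq_of_lt (by omega)
  have hcorners : ∀ (t : ℕ) (x : (Fin t → ℕ) × (Fin t → ℕ)),
      x ∈ nestedPairs (corners lam).card d t →
      ((addCorners lam x.1 x.2).isSome ∧ (remCorners lam x.1 x.2).isSome) ∧
      rowDet (exchangeMatrix f g (exchangeSet (fun k => B (x.1 k)) fun k => T (x.2 k))) =
        (-1) ^ t * ((addCorners lam x.1 x.2).elim 0 Z₁ * (remCorners lam x.1 x.2).elim 0 Z₂) := by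
    rintro t ⟨p, q⟩ hx
    obtain ⟨hp, hq, hpm, hqm⟩ := mem_nestedPairs.1 hx
    dsimp only at hp hq hpm hqm ⊢
    have hpq : ∀ i j, p i ≤ q j := fun i j => (hp i).2.trans (hq j).1
    have hpn : ∀ k, p k ≤ (corners lam).card := fun k => (hp k).2.trans hdn
    have hq1 : ∀ k, 1 ≤ q k := fun k => hd.trans (hq k).1
    obtain ⟨ν, hν, -, hνhigh, -, σ, hσ, hνrows, -⟩ := addCorners_eq_some hB hT h (g := g)
      (fun i hi => if_pos hi) (fun k => (hp k).1) (fun k => (hq k).2) hpq hpm hqm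
    obtain ⟨μ, hμ, -, hμhigh, τ, hτ, hμrows, -⟩ := remCorners_eq_some hB hT h e
      (fun k => (hp k).1) (fun k => (hq k).2) hpq hpm hqm
    have hνcol : ν.colLen 0 ≤ lam.colLen 0 + 1 := by
      rw [colLen_zero_le_iff, hνhigh]
      · exact rowLen_eq_zero_iff.2 (Nat.le_succ _)
      · exact fun k => Nat.lt_succ_of_le (cornerRow_le_colLen (hq1 k) (hq k).2)
    have hμcol : μ.colLen 0 ≤ lam.colLen 0 := by
      rw [colLen_zero_le_iff, hμhigh]
      · exact rowLen_eq_zero_iff.2 le_rfl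
      · exact fun k => cornerRow_le_colLen (hq1 k) (hq k).2
    have hBinj : Function.Injective fun k => B (p k) := by
      intro a b hab
      have h1 := congrArg Fin.val hab
      dsimp only at h1
      rw [hB _ (hp a).1 (hpn a), hB _ (hp b).1 (hpn b)] at h1
      have h3 := (cornerRow_spec (hp a).1 (hpn a)).1
      have h4 := (cornerRow_spec (hp b).1 (hpn b)).1
      rcases lt_trichotomy a b with h2 | h2 | h2
      · have := cornerRow_lt (hp a).1 (hpm h2) (hpn b)
        omega
      · exact h2
      · have := cornerRow_lt (hp b).1 (hpm h2) (hpn a)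
        omega
    have hTinj : Function.Injective fun k => T (q k) := by
      intro a b hab
      have h1 := congrArg Fin.val hab
      dsimp only at h1
      rw [hT _ (hq1 a) (hq a).2, hT _ (hq1 b) (hq b).2] at h1
      rcases lt_trichotomy a b with h2 | h2 | h2
      · have := cornerRow_lt (hq1 b) (hqm h2) (hq a).2
        omega
      · exact h2
      · have := cornerRow_lt (hq1 a) (hqm h2) (hq b).2
        omega
    refine ⟨by rw [hν, hμ]; exact ⟨rfl, rfl⟩, ?_⟩
    have hZν : Z₁ ν = (Equiv.Perm.sign σ : ℂ) *
        rowDet (Function.extend (fun k => T (q k)) (fun k => g (B (p k))) f) :=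
      (hZ₁ ν hνcol).trans ((congrArg rowDet hνrows).trans (rowDet_comp_perm σ _))
    have hZμ : Z₂ μ = (Equiv.Perm.sign τ : ℂ) *
        rowDet (Function.extend (fun k => B (p k)) (fun k => f (T (q k))) g) :=
      (hZ₂' μ hμcol).trans ((congrArg rowDet hμrows).trans (rowDet_comp_perm τ _))
    -- Both signs are `(-1)` to the same sum of strip heights.
    have hone : ((Equiv.Perm.sign σ : ℤ) : ℂ) * (Equiv.Perm.sign τ : ℤ) = 1 := by
      rw [hσ, hτ, ← Int.cast_mul, ← Units.val_mul, ← pow_add, ← two_mul, pow_mul]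
      simp
    rw [rowDet_exchangeMatrix_exchangeSet hBinj hTinj, hν, hμ, Option.elim_some, Option.elim_some,
      hZν, hZμ, mul_mul_mul_comm, hone, one_mul]
  obtain ⟨ν, hν, hνrow⟩ := subOnes_eq_some lam (l := cornerRow lam d) hlspec.2
  obtain ⟨μ, hμ, hμrow⟩ := addOnes_eq_some lam (l := cornerRow lam d) hlk
  refine ⟨⟨by rw [hν]; rfl, by rw [hμ]; rfl, fun t _ x hx => (hcorners t x hx).1⟩, ?_⟩
  let L : Finset (Fin (lam.colLen 0 + 1)) :=
    Finset.univ.filter fun i => (i : ℕ) < cornerRow lam d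
  have hL : ∀ i, i ∈ L ↔ (i : ℕ) < cornerRow lam d := fun i => by simp [L]
  have hsub : Z₁ ν = rowDet fun i => if i ∈ L then g i else f i := by
    rw [hZ₁ ν (colLen_zero_le_iff.2 (by
      rw [hνrow, if_neg (by omega), rowLen_eq_zero_iff]
      exact Nat.le_succ _))]
    congr 1
    funext i
    have h1 := hνrow i
    by_cases hi : (i : ℕ) < cornerRow lam d
    · have h2 := (rowLen_eq_zero_iff (μ := lam) (i := (i : ℕ))).1
      rw [if_pos hi] at h1
      rw [if_pos ((hL i).2 hi)]
      dsimp only [g]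
      rw [if_pos (by omega), h1]
      funext s
      dsimp only [h]
      congr 1
      omega
    · rw [if_neg hi] at h1
      rw [if_neg fun h => hi ((hL i).1 h), h1]
  have hadd : Z₂ μ = rowDet fun i => if i ∈ L then f i else g i := by
    rw [hZ₂' μ (colLen_zero_le_iff.2 (by
      rw [hμrow, if_neg (by omega), rowLen_eq_zero_iff]))]
    congr 1
    funext i
    have h1 := hμrow i
    by_cases hi : (i : ℕ) < cornerRow lam d
    · rw [if_pos hi] at h1
      rw [if_pos ((hL i).2 hi), if_pos (by omega), h1]
      funext s
      dsimp only [f, h]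
      congr 1
      omega
    · rw [if_neg hi] at h1
      rw [if_neg fun h => hi ((hL i).1 h), h1]
  -- Within a block of equal rows, `λ_{i+1} - (i + 1) = λ_i - i - 1`: this coincidence kills every
  -- term that moves a row not belonging to a corner.
  have hgf : ∀ i j : Fin (lam.colLen 0 + 1), (j : ℕ) = i + 1 → lam.rowLen i = lam.rowLen j →
      f j = g i := by
    intro i j hij hlen
    dsimp only [f, g]
    rw [if_pos (by omega), hlen, hij]
    congr 1
    push_cast
    ring
  have hsum := sum_exchangeSupport_eq_sum_nestedPairs (n := (corners lam).card) (d := d) (L := L)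
    (B := B) (T := T) (F := fun s => rowDet (exchangeMatrix f g s)) ?_ ?_ ?_ ?_
    (fun s hs => card_eq_of_rowDet_exchangeMatrix_ne_zero hs) ?_ ?_
  · rw [hν, hμ, Option.elim_some, Option.elim_some, hsub, hadd,
      rowDet_mul_rowDet_eq_sum_exchangeMatrix, hsum, Finset.range_eq_Ico,
      Finset.sum_eq_sum_Ico_succ_bot (Nat.succ_pos _)]
    have h0 : ∑ x ∈ nestedPairs (corners lam).card d 0,
        rowDet (exchangeMatrix f g (exchangeSet (fun k => B (x.1 k)) fun k => T (x.2 k))) =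
          Z₁ lam * Z₂ lam := by
      rw [Finset.sum_eq_single_of_mem (Fin.elim0, Fin.elim0)
        (mem_nestedPairs.2 ⟨fun k => k.elim0, fun k => k.elim0, fun k => k.elim0,
          fun k => k.elim0⟩) fun x _ hx => absurd (Subsingleton.elim _ _) hx,
        (hcorners 0 _ (mem_nestedPairs.2 ⟨fun k => k.elim0, fun k => k.elim0, fun k => k.elim0,
          fun k => k.elim0⟩)).2, pow_zero, one_mul]
      rfl
    -- With the term `t = 0` cancelled, the sums over `t ≥ 1` occur with the opposite signs `(-1)^t`
    -- and `(-1)^(t-1)`.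
    rw [h0, add_assoc, left_eq_add]
    have hIcc : Finset.Ico (0 + 1) (min d ((corners lam).card - d + 1) + 1) =
        Finset.Icc 1 (min d ((corners lam).card - d + 1)) := rfl
    rw [hIcc, ← Finset.sum_add_distrib]
    refine Finset.sum_eq_zero fun t ht => ?_
    obtain ⟨t, rfl⟩ := Nat.exists_eq_add_of_le' (Finset.mem_Icc.1 ht).1
    rw [Finset.sum_congr rfl fun x hx => (hcorners _ x hx).2, ← Finset.mul_sum,
      Nat.add_sub_cancel, pow_succ]
    ring
  · intro p hp q hq hpq
    have h1 := congrArg Fin.val hpq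
    have hpn := hp.2.trans hdn
    have hqn := hq.2.trans hdn
    rw [hB p hp.1 hpn, hB q hq.1 hqn] at h1
    have h3 := (cornerRow_spec hp.1 hpn).1
    have h4 := (cornerRow_spec hq.1 hqn).1
    rcases lt_trichotomy p q with h2 | h2 | h2
    · have := cornerRow_lt hp.1 h2 hqn
      omega
    · exact h2
    · have := cornerRow_lt hq.1 h2 hpn
      omega
  · intro p hp
    have h1 := cornerRow_le hp.1 hp.2 hdn
    have h2 := (cornerRow_spec hp.1 (hp.2.trans hdn)).1
    rw [hL, hB p hp.1 (hp.2.trans hdn)]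
    omega
  · intro p hp q hq hpq
    have h1 := congrArg Fin.val hpq
    have hp1 := hd.trans hp.1
    have hq1 := hd.trans hq.1
    rw [hT p hp1 hp.2, hT q hq1 hq.2] at h1
    rcases lt_trichotomy p q with h2 | h2 | h2
    · have := cornerRow_lt hp1 h2 hq.2
      omega
    · exact h2
    · have := cornerRow_lt hq1 h2 hp.2
      omega
  · intro q hq
    have h1 := cornerRow_le hd hq.1 hq.2
    rw [hL, hT q (hd.trans hq.1) hq.2]
    omega
  · intro s hs hne i hi
    have hiL := (hL i).1 (inr_mem_exchangeSupport.1 (hs hi))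
    by_cases hlt : lam.rowLen (i + 1) < lam.rowLen i
    · obtain ⟨p, hp1, hp2, hp3⟩ := exists_cornerRow_eq hlt
      refine ⟨p, ⟨hp1, ?_⟩, Fin.ext ?_⟩
      · by_contra hpd
        have := cornerRow_lt hd (not_le.1 hpd) hp2
        omega
      · rw [hB p hp1 hp2, hp3, Nat.add_sub_cancel]
    · refine absurd ?_ hne
      have hlen := le_antisymm (not_lt.1 hlt) (lam.rowLen_anti i (i + 1) (Nat.le_succ _))
      -- Row `r_d - 1` is a corner row and row `i` is not, so row `i + 1` lies in `L` too; there
      -- `f_{i+1}` stays unmoved and equals the moved `g_i`.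
      have hi1 : (i : ℕ) + 1 < cornerRow lam d := by
        by_contra hge
        have h1 : cornerRow lam d = i + 1 := by omega
        rw [h1, Nat.add_sub_cancel] at hlspec
        omega
      refine rowDet_exchangeMatrix_eq_zero_of_inr hi (j := ⟨i + 1, by omega⟩) (fun hj => ?_)
        (hgf _ _ rfl hlen)
      exact inl_mem_exchangeSupport.1 (hs hj) ((hL _).2 hi1)
  · intro s hs hne j hj
    have hjL : ¬ (j : ℕ) < cornerRow lam d := fun h =>
      inl_mem_exchangeSupport.1 (hs hj) ((hL j).2 h)
    obtain ⟨i, hi⟩ : ∃ i, (j : ℕ) = i + 1 := ⟨j - 1, by omega⟩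
    by_cases hlt : lam.rowLen (i + 1) < lam.rowLen i
    · obtain ⟨q, hq1, hq2, hq3⟩ := exists_cornerRow_eq hlt
      refine ⟨q, ⟨?_, hq2⟩, Fin.ext ?_⟩
      · by_contra hqd
        have := cornerRow_lt hq1 (not_le.1 hqd) hdn
        omega
      · rw [hT q hq1 hq2, hq3, hi]
    · refine absurd ?_ hne
      have hlen := le_antisymm (not_lt.1 hlt) (lam.rowLen_anti i (i + 1) (Nat.le_succ _))
      -- Likewise row `j - 1` is not the corner row `r_d - 1`, so it lies outside `L`; there
      -- `g_{j-1}` stays unmoved and equals the moved `f_j`.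
      have hi1 : cornerRow lam d ≤ i := by
        by_contra hge
        have h1 : cornerRow lam d = i + 1 := by omega
        rw [h1, Nat.add_sub_cancel] at hlspec
        omega
      refine rowDet_exchangeMatrix_eq_zero_of_inl hj (i := ⟨i, by omega⟩) (fun hi' => ?_)
        (hgf _ _ hi (by rw [hi]; exact hlen))
      have := (hL _).1 (inr_mem_exchangeSupport.1 (hs hi'))
      dsimp only at this
      omega

/-! ### Conjugation, and specialisation to the zeta functions. -/

theorem rowLengths_eq_colHeights_transpose (lam : YoungDiagram) :
    rowLengths lam = colHeights lam.transpose := by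
  rw [rowLengths, colHeights, YoungDiagram.rowLen_transpose]
  exact Finset.image_congr fun i _ => (YoungDiagram.colLen_transpose lam i).symm

theorem card_corners_transpose (lam : YoungDiagram) :
    (corners lam.transpose).card = (corners lam).card := by
  refine Finset.card_nbij' Prod.swap Prod.swap ?_ ?_ ?_ ?_
  · rintro ⟨i, j⟩
    simp only [corners, Finset.coe_filter, Set.mem_ofPred_eq, YoungDiagram.mem_cells,
      YoungDiagram.mem_transpose, Prod.swap_prod_mk]
    exact fun h => ⟨h.1, h.2.2, h.2.1⟩
  · rintro ⟨i, j⟩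
    simp only [corners, Finset.coe_filter, Set.mem_ofPred_eq, YoungDiagram.mem_cells,
      YoungDiagram.mem_transpose, Prod.swap_prod_mk]
    exact fun h => ⟨h.1, h.2.2, h.2.1⟩
  · simp [Set.LeftInvOn]
  · simp [Set.LeftInvOn]

theorem diagZeta_eq_elim (M : ℕ) (o : Option YoungDiagram) (a : ℤ → ℂ) :
    diagZeta M o a = o.elim 0 fun ν => diagZeta M (some ν) a := by
  cases o <;> rfl

theorem diagZeta_conjDiagram_eq_elim (M : ℕ) (o : Option YoungDiagram) (a : ℤ → ℂ) :
    diagZeta M (conjDiagram o) a = o.elim 0 fun ν => diagZeta M (some ν.transpose) a := by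
  cases o <;> rfl

theorem diagZeta_eq_rowDet_hCoeff (M : ℕ) (a : ℤ → ℂ) {ν : YoungDiagram} {N : ℕ}
    (hN : ν.colLen 0 ≤ N) :
    diagZeta M (some ν) a = rowDet fun i s : Fin N =>
      hCoeff (fun t c => (t : ℂ) ^ (-(a c))) M (-(s : ℕ)) ((ν.rowLen i : ℤ) - (i : ℕ)) := by
  rw [diagZeta_some_eq_tableauSum, tableauSum_eq_rowDet_hCoeff _ _ hN]

theorem diagZeta_transpose_eq_rowDet_eCoeff (M : ℕ) (a : ℤ → ℂ) {ν : YoungDiagram} {N : ℕ}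
    (hN : ν.colLen 0 ≤ N) :
    diagZeta M (some ν.transpose) a = rowDet fun i s : Fin N =>
      eCoeff (fun t c => (t : ℂ) ^ (-(a (-c)))) M (-(s : ℕ)) ((ν.rowLen i : ℤ) - (i : ℕ)) := by
  rw [diagZeta_some_eq_tableauSum, ← tableauSum_transpose_eq_rowDet_eCoeff _ _ hN]
  simp only [neg_neg]

end SchurZeta

theorem mainTheorem11 (M : ℕ) (a : ℤ → ℂ) (lam : YoungDiagram) (n : ℕ)
    (hn : (corners lam).card = n) (d : ℕ) (hd : 1 ≤ d) (hdn : d ≤ n) :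
    -- (1) the column version, with `l` the `d`-th shortest column height of `lam`
    (∀ l : ℕ, l = nthSmallest (colHeights lam) d →
      ((subOnes lam l).isSome ∧ (addOnes lam l).isSome ∧
        ∀ t ∈ Finset.Icc 1 (min d (n - d + 1)), ∀ x ∈ nestedPairs n d t,
          (addCorners lam x.1 x.2).isSome ∧ (remCorners lam x.1 x.2).isSome) ∧
      diagZeta M (some lam) a * diagZeta M (some lam) (shift (-1) a) =
        diagZeta M (subOnes lam l) a * diagZeta M (addOnes lam l) (shift (-1) a) +
        ∑ t ∈ Finset.Icc 1 (min d (n - d + 1)), (-1 : ℂ) ^ (t - 1) *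
          ∑ x ∈ nestedPairs n d t,
            diagZeta M (addCorners lam x.1 x.2) a *
              diagZeta M (remCorners lam x.1 x.2) (shift (-1) a)) ∧
    -- (2) the row version, with `l` the `d`-th shortest row length of `lam`
    (∀ l : ℕ, l = nthSmallest (rowLengths lam) d →
      ((subOnes lam.transpose l).isSome ∧ (addOnes lam.transpose l).isSome ∧
        ∀ t ∈ Finset.Icc 1 (min d (n - d + 1)), ∀ x ∈ nestedPairs n d t,
          (addCorners lam.transpose x.1 x.2).isSome ∧
            (remCorners lam.transpose x.1 x.2).isSome) ∧
      diagZeta M (some lam) a * diagZeta M (some lam) (shift 1 a) =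
        diagZeta M (conjDiagram (subOnes lam.transpose l)) a *
          diagZeta M (conjDiagram (addOnes lam.transpose l)) (shift 1 a) +
        ∑ t ∈ Finset.Icc 1 (min d (n - d + 1)), (-1 : ℂ) ^ (t - 1) *
          ∑ x ∈ nestedPairs n d t,
            diagZeta M (conjDiagram (addCorners lam.transpose x.1 x.2)) a *
              diagZeta M (conjDiagram (remCorners lam.transpose x.1 x.2)) (shift 1 a)) := by
  constructor
  · intro l hl
    have key := exchange_identity hn hd hdn
      (H := hCoeff (fun t c => (t : ℂ) ^ (-(a c))) M)
      (Z₁ := fun ν => diagZeta M (some ν) a) (Z₂ := fun ν => diagZeta M (some ν) (shift (-1) a))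
      (fun ν hν => diagZeta_eq_rowDet_hCoeff M a hν)
      (fun ν hν => by
        rw [diagZeta_eq_rowDet_hCoeff M (shift (-1) a) hν]
        simp only [hCoeff_sub_one]
        rfl) hl
    simpa only [← diagZeta_eq_elim] using key
  · intro l hl
    rw [rowLengths_eq_colHeights_transpose] at hl
    have key := exchange_identity ((card_corners_transpose lam).trans hn) hd hdn
      (H := eCoeff (fun t c => (t : ℂ) ^ (-(a (-c)))) M)
      (Z₁ := fun ν => diagZeta M (some ν.transpose) a)
      (Z₂ := fun ν => diagZeta M (some ν.transpose) (shift 1 a))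
      (fun ν hν => diagZeta_transpose_eq_rowDet_eCoeff M a hν)
      (fun ν hν => by
        -- Conjugation negates contents, so the shift by `+1` acts on the conjugate as a shift by
        -- `-1`, the same as in the column version.
        have hshift : ∀ c : ℤ, shift 1 a (-c) = a (-(c - 1)) := fun c => by
          rw [shift]
          congr 1
          ring
        rw [diagZeta_transpose_eq_rowDet_eCoeff M (shift 1 a) hν]
        simp only [eCoeff_sub_one, hshift]) hl
    simpa only [← diagZeta_conjDiagram_eq_elim, YoungDiagram.transpose_transpose] using key
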